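/- Let $N\ge 1$ and let $\Omega\subset\mathbb{R}^N$ be a nonempty bounded open set (not necessarily connected, and with no regularity assumption on $\partial\Omega$). For $1<p<\infty$, let $W^{1,p}_0(\Omega)$ be the closure of $C_c^\infty(\Omega)$ in $W^{1,p}(\Omega)$, let $$W^{1,p_-}_0(\Omega)=W^{1,p}(\Omega)\cap\bigcap_{1<s<p}W^{1,s}_0(\Omega),$$ and set $$\lambda_p^{(1)}=\inf\left\{\frac{\int_\Omega|\nabla u|^p\,dx}{\int_\Omega|u|^p\,dx}:\ u\in W^{1,p}_0(\Omega)\setminus\{0\}\right\},\qquad \underline{\lambda}_p^{(1)}=\inf\left\{\frac{\int_\Omega|\nabla u|^p\,dx}{\int_\Omega|u|^p\,dx}:\ u\in W^{1,p_-}_0(\Omega)\setminus\{0\}\right\}.$$ Then for all $1<s<p<\infty$, $$s\left(\underline{\lambda}_s^{(1)}\right)^{1/s}\le s\left(\lambda_s^{(1)}\right)^{1/s}<p\left(\underline{\lambda}_p^{(1)}\right)^{1/p}\le p\left(\lambda_p^{(1)}\right)^{1/p}.$$ -/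

import Mathlib

open MeasureTheory Filter Topology TopologicalSpace
open scoped Distributions

namespace PLaplace

variable {N : ℕ}

/-- `g` is the weak (distributional) gradient of `u` on the open set `Ω`: both are locally
integrable on `Ω`, and `∫_Ω u ∂ᵢφ = - ∫_Ω gᵢ φ` for all `φ ∈ C_c^∞(Ω)` and every coordinate `i`. -/
def HasWeakGradient (Ω : Opens (EuclideanSpace ℝ (Fin N))) (u : EuclideanSpace ℝ (Fin N) → ℝ)
    (g : EuclideanSpace ℝ (Fin N) → EuclideanSpace ℝ (Fin N)) : Prop :=
  LocallyIntegrableOn u Ω ∧ LocallyIntegrableOn g Ω ∧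
    ∀ (φ : 𝓓(Ω, ℝ)) (i : Fin N),
      ∫ x in (Ω : Set (EuclideanSpace ℝ (Fin N))),
          u x * fderiv ℝ φ x (EuclideanSpace.single i 1) =
        - ∫ x in (Ω : Set (EuclideanSpace ℝ (Fin N))), g x i * φ x

/-- `u ∈ W^{1,p}(Ω)`: `u ∈ L^p(Ω)` and `u` has a weak gradient in `L^p(Ω)`. -/
def MemW1 (Ω : Opens (EuclideanSpace ℝ (Fin N))) (p : ℝ)
    (u : EuclideanSpace ℝ (Fin N) → ℝ) : Prop :=
  MemLp u (ENNReal.ofReal p) (volume.restrict Ω) ∧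
    ∃ g : EuclideanSpace ℝ (Fin N) → EuclideanSpace ℝ (Fin N),
      HasWeakGradient Ω u g ∧ MemLp g (ENNReal.ofReal p) (volume.restrict Ω)

/-- `u ∈ W₀^{1,p}(Ω)`: `u` belongs to the closure of `C_c^∞(Ω)` in `W^{1,p}(Ω)`, that is,
`u ∈ W^{1,p}(Ω)` and there are test functions `φₖ` with `φₖ → u` and `∇φₖ → ∇u` in `L^p(Ω)`. -/
def MemW10 (Ω : Opens (EuclideanSpace ℝ (Fin N))) (p : ℝ)
    (u : EuclideanSpace ℝ (Fin N) → ℝ) : Prop :=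
  MemW1 Ω p u ∧
    ∃ g : EuclideanSpace ℝ (Fin N) → EuclideanSpace ℝ (Fin N), HasWeakGradient Ω u g ∧
      ∃ φ : ℕ → 𝓓(Ω, ℝ),
        Tendsto (fun k ↦ eLpNorm (fun x ↦ φ k x - u x) (ENNReal.ofReal p) (volume.restrict Ω))
          atTop (𝓝 0) ∧
        Tendsto (fun k ↦ eLpNorm (fun x ↦ gradient (φ k) x - g x) (ENNReal.ofReal p)
          (volume.restrict Ω)) atTop (𝓝 0)

/-- `u ∈ W₀^{1,p₋}(Ω) = W^{1,p}(Ω) ∩ ⋂_{1<s<p} W₀^{1,s}(Ω)`. -/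
def MemW10Minus (Ω : Opens (EuclideanSpace ℝ (Fin N))) (p : ℝ)
    (u : EuclideanSpace ℝ (Fin N) → ℝ) : Prop :=
  MemW1 Ω p u ∧ ∀ s : ℝ, 1 < s → s < p → MemW10 Ω s u

/-- The set of Rayleigh quotients `∫_Ω |∇u|^p / ∫_Ω |u|^p` of the nonzero elements `u` of a class
`V` of functions; nonzero means not almost everywhere zero on `Ω`. -/
def rayleighQuotients (Ω : Opens (EuclideanSpace ℝ (Fin N))) (p : ℝ)
    (V : (EuclideanSpace ℝ (Fin N) → ℝ) → Prop) : Set ℝ :=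
  {r | ∃ (u : EuclideanSpace ℝ (Fin N) → ℝ)
      (g : EuclideanSpace ℝ (Fin N) → EuclideanSpace ℝ (Fin N)),
    V u ∧ HasWeakGradient Ω u g ∧ ¬ (u =ᵐ[volume.restrict Ω] 0) ∧
      r = (∫ x in (Ω : Set (EuclideanSpace ℝ (Fin N))), ‖g x‖ ^ p) /
        ∫ x in (Ω : Set (EuclideanSpace ℝ (Fin N))), |u x| ^ p}

/-- The first eigenvalue `λ_p^{(1)}`: infimum of the Rayleigh quotient over
`W₀^{1,p}(Ω) \ {0}`. -/
noncomputable def firstEigenvalue (Ω : Opens (EuclideanSpace ℝ (Fin N))) (p : ℝ) : ℝ :=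
  sInf (rayleighQuotients Ω p (MemW10 Ω p))

/-- The number `λ̲_p^{(1)}`: infimum of the Rayleigh quotient over `W₀^{1,p₋}(Ω) \ {0}`. -/
noncomputable def firstEigenvalueMinus (Ω : Opens (EuclideanSpace ℝ (Fin N))) (p : ℝ) : ℝ :=
  sInf (rayleighQuotients Ω p (MemW10Minus Ω p))

end PLaplace

/-! For `u` in the larger class, `|u|^{p/s}` is an admissible competitor for exponent `s`, its
gradient having norm `(p/s)|u|^{p/s-1}|∇u|`. Hence `λ_s ∫|u|^p ≤ (p/s)^s ∫|u|^{p-s}|∇u|^s`, and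
Hölder's inequality already gives the comparison with `≤`. Approximation of `u` is needed only in
exponents `r < p`, which is what `W₀^{1,p₋}` provides; this is why the infimum over the larger class
appears on the right.

Strictness is obtained without a minimiser, by bounding the loss in Hölder's inequality from below
uniformly in `u`. Let `K^p` exceed the Rayleigh quotient of `u`, put `A = |u|`, `B = |∇u|/K`, and
let `d ≥ 0` be the defect in Young's inequality for `A^{p-s}B^s`. If `∫d` were small, `B` would be
essentially bounded by a multiple of `A`: pointwise `A^{p-1}B ≤ M A^p + C d`
(`rpow_mul_le_young_defect`). Integrating `∂ᵢ|u|^p` against `exp(a xᵢ)` gives `a ∫ exp(a xᵢ)|u|^p ≤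
p ∫ exp(a xᵢ)|u|^{p-1}|∇u|`. For large `a` the `M`-term is absorbed on the left, so `∫d` is at least
a fixed multiple of `∫|u|^p` (`exists_pos_mul_integral_le`). The same bound forces the eigenvalue
for `p` to be positive, so no Poincaré inequality is needed beforehand. -/

namespace PLaplace

open scoped ENNReal ContDiff

/-! ### Test functions and uniqueness of weak gradients -/

/-- Dominated convergence for `L^q` seminorms. -/
theorem tendsto_eLpNorm_zero_of_dominated {α F : Type*} [MeasurableSpace α] [NormedAddCommGroup F]
    {μ : Measure α} {q : ℝ≥0∞} (hq : q ≠ 0) (hq' : q ≠ ⊤) {f : ℕ → α → F} {b : α → ℝ}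
    (hf : ∀ n, AEStronglyMeasurable (f n) μ) (hb : MemLp b q μ)
    (hle : ∀ n, ∀ᵐ x ∂μ, ‖f n x‖ ≤ b x) (hlim : ∀ᵐ x ∂μ, Tendsto (fun n ↦ f n x) atTop (𝓝 0)) :
    Tendsto (fun n ↦ eLpNorm (f n) q μ) atTop (𝓝 0) := by
  have hq0 : 0 < q.toReal := ENNReal.toReal_pos hq hq'
  have key : Tendsto (fun n ↦ ∫⁻ x, ‖f n x‖ₑ ^ q.toReal ∂μ) atTop (𝓝 (∫⁻ _, 0 ∂μ)) := by
    refine tendsto_lintegral_of_dominated_convergence' (fun x ↦ ‖b x‖ₑ ^ q.toReal)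
      (fun n ↦ (hf n).enorm.pow_const _) (fun n ↦ ?_) ?_ ?_
    · filter_upwards [hle n] with x hx
      gcongr
      rw [enorm_le_iff_norm_le]
      exact hx.trans (le_abs_self _)
    · exact (lintegral_rpow_enorm_lt_top_of_eLpNorm_lt_top hq hq' hb.2).ne
    · filter_upwards [hlim] with x hx
      have := (hx.enorm).ennrpow_const q.toReal
      simpa [ENNReal.zero_rpow_of_pos hq0] using this
  simp_rw [eLpNorm_eq_lintegral_rpow_enorm_toReal hq hq']
  have := key.ennrpow_const (1 / q.toReal)
  simpa [ENNReal.zero_rpow_of_pos (inv_pos.2 hq0)] using this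

variable {N : ℕ} {Ω : Opens (EuclideanSpace ℝ (Fin N))}

theorem gradient_apply_eq_fderiv (f : EuclideanSpace ℝ (Fin N) → ℝ) (x : EuclideanSpace ℝ (Fin N))
    (i : Fin N) : gradient f x i = fderiv ℝ f x (EuclideanSpace.single i 1) := by
  have := InnerProductSpace.toDual_symm_apply (𝕜 := ℝ) (x := EuclideanSpace.single i (1 : ℝ))
    (y := fderiv ℝ f x)
  rw [EuclideanSpace.inner_single_right] at this
  simpa [gradient] using this

theorem continuous_gradient (φ : 𝓓(Ω, ℝ)) : Continuous (gradient φ) :=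
  (InnerProductSpace.toDual ℝ _).symm.continuous.comp
    (φ.contDiff.continuous_fderiv (by simp))

theorem hasCompactSupport_gradient (φ : 𝓓(Ω, ℝ)) : HasCompactSupport (gradient φ) :=
  (φ.hasCompactSupport.fderiv ℝ).comp_left (map_zero (InnerProductSpace.toDual ℝ _).symm)

theorem memLp_testFunction (φ : 𝓓(Ω, ℝ)) (q : ℝ≥0∞) :
    MemLp φ q (volume.restrict (Ω : Set (EuclideanSpace ℝ (Fin N)))) :=
  (φ.continuous.memLp_of_hasCompactSupport φ.hasCompactSupport).restrict _

theorem memLp_gradient (φ : 𝓓(Ω, ℝ)) (q : ℝ≥0∞) :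
    MemLp (gradient φ) q (volume.restrict (Ω : Set (EuclideanSpace ℝ (Fin N)))) :=
  ((continuous_gradient φ).memLp_of_hasCompactSupport (hasCompactSupport_gradient φ)).restrict _

theorem testFunction_eq_zero (φ : 𝓓(Ω, ℝ)) {x : EuclideanSpace ℝ (Fin N)}
    (hx : x ∉ (Ω : Set (EuclideanSpace ℝ (Fin N)))) : φ x = 0 :=
  image_eq_zero_of_notMem_tsupport fun h ↦ hx (φ.tsupport_subset h)

theorem fderiv_testFunction_eq_zero (φ : 𝓓(Ω, ℝ)) {x : EuclideanSpace ℝ (Fin N)}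
    (hx : x ∉ (Ω : Set (EuclideanSpace ℝ (Fin N)))) : fderiv ℝ φ x = 0 :=
  image_eq_zero_of_notMem_tsupport
    fun h ↦ hx (φ.tsupport_subset (tsupport_fderiv_subset ℝ h))

/-- Integration by parts of a test function against a smooth function. -/
theorem setIntegral_mul_fderiv_testFunction {w : EuclideanSpace ℝ (Fin N) → ℝ}
    (hw : ContDiff ℝ ∞ w) (φ : 𝓓(Ω, ℝ)) (e : EuclideanSpace ℝ (Fin N)) :
    ∫ x in (Ω : Set (EuclideanSpace ℝ (Fin N))), w x * fderiv ℝ φ x e =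
      - ∫ x in (Ω : Set (EuclideanSpace ℝ (Fin N))), fderiv ℝ w x e * φ x := by
  rw [setIntegral_eq_integral_of_forall_compl_eq_zero
      (fun x hx ↦ by simp [fderiv_testFunction_eq_zero φ hx]),
    setIntegral_eq_integral_of_forall_compl_eq_zero
      (fun x hx ↦ by simp [testFunction_eq_zero φ hx])]
  have hw' : Continuous (fderiv ℝ w) := hw.continuous_fderiv (by simp)
  have hφ' : Continuous (fderiv ℝ φ) := φ.contDiff.continuous_fderiv (by simp)
  have hwc := hw.continuous
  have hφc := φ.continuous
  refine integral_mul_fderiv_eq_neg_fderiv_mul_of_integrable ?_ ?_ ?_ ?_ ?_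
  · exact Continuous.integrable_of_hasCompactSupport (by fun_prop) φ.hasCompactSupport.mul_left
  · exact Continuous.integrable_of_hasCompactSupport (by fun_prop)
      ((φ.hasCompactSupport.fderiv_apply ℝ e).mul_left)
  · exact Continuous.integrable_of_hasCompactSupport (by fun_prop) φ.hasCompactSupport.mul_left
  · exact fun x _ ↦ hw.differentiable (by simp) x
  · exact fun x _ ↦ φ.contDiff.differentiable (by simp) x

theorem hasWeakGradient_testFunction (φ : 𝓓(Ω, ℝ)) : HasWeakGradient Ω φ (gradient φ) := by
  refine ⟨φ.continuous.continuousOn.locallyIntegrableOn Ω.isOpen.measurableSet,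
    (continuous_gradient φ).continuousOn.locallyIntegrableOn Ω.isOpen.measurableSet, ?_⟩
  intro ψ i
  simp_rw [gradient_apply_eq_fderiv]
  exact setIntegral_mul_fderiv_testFunction φ.contDiff ψ _

/-- The fundamental lemma of the calculus of variations, in each coordinate. It reconciles the
gradients that `MemW1`, `MemW10` and `rayleighQuotients` quantify independently of one another. -/
theorem HasWeakGradient.ae_eq {u : EuclideanSpace ℝ (Fin N) → ℝ}
    {g h : EuclideanSpace ℝ (Fin N) → EuclideanSpace ℝ (Fin N)}
    (hg : HasWeakGradient Ω u g) (hh : HasWeakGradient Ω u h) :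
    g =ᵐ[volume.restrict (Ω : Set (EuclideanSpace ℝ (Fin N)))] h := by
  have key : ∀ i : Fin N, ∀ᵐ x, x ∈ (Ω : Set (EuclideanSpace ℝ (Fin N))) → (g x - h x) i = 0 := by
    intro i
    have hloc : ∀ {k : EuclideanSpace ℝ (Fin N) → EuclideanSpace ℝ (Fin N)},
        LocallyIntegrableOn k (Ω : Set (EuclideanSpace ℝ (Fin N))) →
        LocallyIntegrableOn (fun x ↦ k x i) (Ω : Set (EuclideanSpace ℝ (Fin N))) := by
      intro k hk x hx
      obtain ⟨s, hs, hks⟩ := hk x hx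
      exact ⟨s, hs, (EuclideanSpace.proj (𝕜 := ℝ) i).integrable_comp hks⟩
    refine Ω.isOpen.ae_eq_zero_of_integral_contDiff_smul_eq_zero
      ((hloc hg.2.1).sub (hloc hh.2.1)) ?_
    intro φ hφ hφc hφs
    let Φ : 𝓓(Ω, ℝ) := ⟨φ, hφ, hφc, hφs⟩
    have e := (hg.2.2 Φ i).symm.trans (hh.2.2 Φ i)
    have hΦ : (Φ : EuclideanSpace ℝ (Fin N) → ℝ) = φ := rfl
    have hint : ∀ {k : EuclideanSpace ℝ (Fin N) → EuclideanSpace ℝ (Fin N)},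
        LocallyIntegrableOn k (Ω : Set (EuclideanSpace ℝ (Fin N))) →
        Integrable (fun x ↦ k x i * Φ x)
          (volume.restrict (Ω : Set (EuclideanSpace ℝ (Fin N)))) := by
      intro k hk
      have hK : IntegrableOn (fun x ↦ k x i) (tsupport φ) :=
        (hloc hk).integrableOn_compact_subset hφs hφc
      have hKφ : IntegrableOn (fun x ↦ k x i * φ x) (tsupport φ) :=
        hK.mul_continuousOn hφ.continuous.continuousOn hφc
      rw [integrableOn_iff_integrable_of_support_subset
        ((Function.support_mul_subset_right _ _).trans (subset_tsupport φ))] at hKφ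
      exact hKφ.restrict
    have hsub := integral_sub (hint hg.2.1) (hint hh.2.1)
    rw [neg_inj.1 e, sub_self] at hsub
    rw [← hsub, setIntegral_eq_integral_of_forall_compl_eq_zero
      (fun x hx ↦ by simp [testFunction_eq_zero Φ hx])]
    refine integral_congr_ae (ae_of_all _ fun x ↦ ?_)
    simp [hΦ]; ring
  rw [EventuallyEq, ae_restrict_iff' Ω.isOpen.measurableSet]
  filter_upwards [ae_all_iff.2 key] with x hx hxΩ
  ext i
  simpa [sub_eq_zero] using hx i hxΩ

theorem memW10_testFunction (φ : 𝓓(Ω, ℝ)) (p : ℝ) : MemW10 Ω p φ := by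
  refine ⟨⟨memLp_testFunction φ _, _, hasWeakGradient_testFunction φ, memLp_gradient φ _⟩, _,
    hasWeakGradient_testFunction φ, fun _ ↦ φ, ?_, ?_⟩ <;> simp

/-! ### Limits of test functions and change of exponent -/

/-- `(v, V)` is a limit of pairs `(ψ, ∇ψ)` in `L^q(Ω)`, with `ψ` ranging over test functions. -/
def IsSobolevLimit (Ω : Opens (EuclideanSpace ℝ (Fin N))) (q : ℝ≥0∞)
    (v : EuclideanSpace ℝ (Fin N) → ℝ)
    (V : EuclideanSpace ℝ (Fin N) → EuclideanSpace ℝ (Fin N)) : Prop :=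
  ∀ η : ℝ≥0∞, 0 < η → ∃ ψ : 𝓓(Ω, ℝ),
    eLpNorm (fun x ↦ ψ x - v x) q (volume.restrict (Ω : Set (EuclideanSpace ℝ (Fin N)))) < η ∧
    eLpNorm (fun x ↦ gradient ψ x - V x) q
      (volume.restrict (Ω : Set (EuclideanSpace ℝ (Fin N)))) < η

variable {q : ℝ≥0∞} {v : EuclideanSpace ℝ (Fin N) → ℝ}
  {V : EuclideanSpace ℝ (Fin N) → EuclideanSpace ℝ (Fin N)}

theorem isSobolevLimit_of_tendsto {φ : ℕ → 𝓓(Ω, ℝ)}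
    (h₁ : Tendsto (fun k ↦ eLpNorm (fun x ↦ φ k x - v x) q
      (volume.restrict (Ω : Set (EuclideanSpace ℝ (Fin N))))) atTop (𝓝 0))
    (h₂ : Tendsto (fun k ↦ eLpNorm (fun x ↦ gradient (φ k) x - V x) q
      (volume.restrict (Ω : Set (EuclideanSpace ℝ (Fin N))))) atTop (𝓝 0)) :
    IsSobolevLimit Ω q v V := by
  intro η hη
  obtain ⟨k, hk₁, hk₂⟩ := ((h₁.eventually_lt_const hη).and (h₂.eventually_lt_const hη)).exists
  exact ⟨φ k, hk₁, hk₂⟩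

theorem IsSobolevLimit.exists_seq (h : IsSobolevLimit Ω q v V) :
    ∃ φ : ℕ → 𝓓(Ω, ℝ),
      Tendsto (fun k ↦ eLpNorm (fun x ↦ φ k x - v x) q
        (volume.restrict (Ω : Set (EuclideanSpace ℝ (Fin N))))) atTop (𝓝 0) ∧
      Tendsto (fun k ↦ eLpNorm (fun x ↦ gradient (φ k) x - V x) q
        (volume.restrict (Ω : Set (EuclideanSpace ℝ (Fin N))))) atTop (𝓝 0) := by
  choose φ h₁ h₂ using fun k : ℕ ↦ h ((k : ℝ≥0∞)⁻¹) (by simp)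
  exact ⟨φ, tendsto_of_tendsto_of_tendsto_of_le_of_le tendsto_const_nhds
      ENNReal.tendsto_inv_nat_nhds_zero (fun _ ↦ zero_le) (fun k ↦ (h₁ k).le),
    tendsto_of_tendsto_of_tendsto_of_le_of_le tendsto_const_nhds
      ENNReal.tendsto_inv_nat_nhds_zero (fun _ ↦ zero_le) (fun k ↦ (h₂ k).le)⟩

theorem tendsto_eLpNorm_zero_of_le_exponent {α F : Type*} [MeasurableSpace α]
    [NormedAddCommGroup F] {μ : Measure α} [IsFiniteMeasure μ] {q r : ℝ≥0∞} (hqr : q ≤ r)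
    (hr : r ≠ ⊤) (hq : q ≠ 0) {f : ℕ → α → F} (hf : ∀ n, AEStronglyMeasurable (f n) μ)
    (h : Tendsto (fun n ↦ eLpNorm (f n) r μ) atTop (𝓝 0)) :
    Tendsto (fun n ↦ eLpNorm (f n) q μ) atTop (𝓝 0) := by
  have hexp : 0 ≤ 1 / q.toReal - 1 / r.toReal := by
    rw [sub_nonneg]
    exact one_div_le_one_div_of_le (ENNReal.toReal_pos hq (ne_top_of_le_ne_top hr hqr))
      (ENNReal.toReal_mono hr hqr)
  have hlim := ENNReal.Tendsto.mul_const (b := μ Set.univ ^ (1 / q.toReal - 1 / r.toReal)) h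
    (Or.inr (ENNReal.rpow_ne_top_of_nonneg hexp (measure_ne_top μ _)))
  rw [zero_mul] at hlim
  exact tendsto_of_tendsto_of_tendsto_of_le_of_le tendsto_const_nhds hlim (fun _ ↦ zero_le)
    (fun n ↦ eLpNorm_le_eLpNorm_mul_rpow_measure_univ hqr (hf n))

variable {u : EuclideanSpace ℝ (Fin N) → ℝ}
  {g : EuclideanSpace ℝ (Fin N) → EuclideanSpace ℝ (Fin N)} {p : ℝ}

theorem MemW1.memLp_weakGradient (hu : MemW1 Ω p u) (hg : HasWeakGradient Ω u g) :
    MemLp g (ENNReal.ofReal p) (volume.restrict (Ω : Set (EuclideanSpace ℝ (Fin N)))) := by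
  obtain ⟨-, h, hh, hLp⟩ := hu
  exact (memLp_congr_ae (hh.ae_eq hg)).1 hLp

theorem MemW10.isSobolevLimit
    [IsFiniteMeasure (volume.restrict (Ω : Set (EuclideanSpace ℝ (Fin N))))]
    (hu : MemW10 Ω p u) (hg : HasWeakGradient Ω u g) {r : ℝ} (hr : 0 < r) (hrp : r ≤ p) :
    IsSobolevLimit Ω (ENNReal.ofReal r) u g := by
  obtain ⟨hu1, h, hh, φ, h₁, h₂⟩ := hu
  have hle := ENNReal.ofReal_le_ofReal hrp
  have h0 : ENNReal.ofReal r ≠ 0 := by simpa using hr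
  have hgL := hu1.memLp_weakGradient hg
  refine isSobolevLimit_of_tendsto (φ := φ)
    (tendsto_eLpNorm_zero_of_le_exponent hle ENNReal.ofReal_ne_top h0 (fun n ↦ ?_) h₁)
    (tendsto_eLpNorm_zero_of_le_exponent hle ENNReal.ofReal_ne_top h0 (fun n ↦ ?_) ?_)
  · exact ((memLp_testFunction (φ n) 1).1.sub hu1.1.1)
  · exact ((memLp_gradient (φ n) 1).1.sub hgL.1)
  · refine h₂.congr fun n ↦ eLpNorm_congr_ae ?_
    filter_upwards [hh.ae_eq hg] with x hx
    rw [hx]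

theorem MemW10.mono_exponent
    [IsFiniteMeasure (volume.restrict (Ω : Set (EuclideanSpace ℝ (Fin N))))]
    (hu : MemW10 Ω p u) {r : ℝ} (hr : 0 < r) (hrp : r ≤ p) : MemW10 Ω r u := by
  have hle := ENNReal.ofReal_le_ofReal hrp
  obtain ⟨h, hh, -⟩ := hu.2
  refine ⟨⟨hu.1.1.mono_exponent hle, h, hh, (hu.1.memLp_weakGradient hh).mono_exponent hle⟩,
    h, hh, (hu.isSobolevLimit hh hr hrp).exists_seq⟩

theorem MemW10.memW10Minus
    [IsFiniteMeasure (volume.restrict (Ω : Set (EuclideanSpace ℝ (Fin N))))]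
    (hu : MemW10 Ω p u) : MemW10Minus Ω p u :=
  ⟨hu.1, fun _ hs hsp ↦ hu.mono_exponent (by linarith) hsp.le⟩

theorem MemW10Minus.isSobolevLimit
    [IsFiniteMeasure (volume.restrict (Ω : Set (EuclideanSpace ℝ (Fin N))))]
    (hu : MemW10Minus Ω p u) (hg : HasWeakGradient Ω u g) {r : ℝ} (hr : 1 ≤ r) (hrp : r < p) :
    IsSobolevLimit Ω (ENNReal.ofReal r) u g :=
  -- The midpoint lies strictly between 1 and `p` even when `r = 1`, an exponent that the definition
  -- of the class excludes.
  (hu.2 ((r + p) / 2) (by linarith) (by linarith)).isSobolevLimit hg (by linarith) (by linarith)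

end PLaplace

/-! ### Chain rule for limits of test functions -/

namespace PLaplace

open scoped ENNReal ContDiff

variable {N : ℕ} {Ω : Opens (EuclideanSpace ℝ (Fin N))} {q : ℝ≥0∞}
  {u v : EuclideanSpace ℝ (Fin N) → ℝ}
  {g V : EuclideanSpace ℝ (Fin N) → EuclideanSpace ℝ (Fin N)}

theorem IsSobolevLimit.of_tendsto (hq : 1 ≤ q) {v' : ℕ → EuclideanSpace ℝ (Fin N) → ℝ}
    {V' : ℕ → EuclideanSpace ℝ (Fin N) → EuclideanSpace ℝ (Fin N)}
    (hv' : ∀ n, AEStronglyMeasurable (v' n)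
      (volume.restrict (Ω : Set (EuclideanSpace ℝ (Fin N)))))
    (hV' : ∀ n, AEStronglyMeasurable (V' n)
      (volume.restrict (Ω : Set (EuclideanSpace ℝ (Fin N)))))
    (hv : AEStronglyMeasurable v (volume.restrict (Ω : Set (EuclideanSpace ℝ (Fin N)))))
    (hV : AEStronglyMeasurable V (volume.restrict (Ω : Set (EuclideanSpace ℝ (Fin N)))))
    (h : ∀ n, IsSobolevLimit Ω q (v' n) (V' n))
    (h₁ : Tendsto (fun n ↦ eLpNorm (fun x ↦ v' n x - v x) q
      (volume.restrict (Ω : Set (EuclideanSpace ℝ (Fin N))))) atTop (𝓝 0))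
    (h₂ : Tendsto (fun n ↦ eLpNorm (fun x ↦ V' n x - V x) q
      (volume.restrict (Ω : Set (EuclideanSpace ℝ (Fin N))))) atTop (𝓝 0)) :
    IsSobolevLimit Ω q v V := by
  intro η hη
  have hη2 : 0 < η / 2 := ENNReal.half_pos hη.ne'
  obtain ⟨n, hn₁, hn₂⟩ := ((h₁.eventually_lt_const hη2).and (h₂.eventually_lt_const hη2)).exists
  obtain ⟨ψ, hψ₁, hψ₂⟩ := h n _ hη2
  refine ⟨ψ, ?_, ?_⟩
  · have e : (fun x ↦ ψ x - v x) = (fun x ↦ ψ x - v' n x) + fun x ↦ v' n x - v x := by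
      ext x; simp
    rw [e]
    refine (eLpNorm_add_le ((memLp_testFunction ψ 1).1.sub (hv' n)) ((hv' n).sub hv) hq).trans_lt ?_
    exact (ENNReal.add_lt_add hψ₁ hn₁).trans_eq (ENNReal.add_halves η)
  · have e : (fun x ↦ gradient ψ x - V x) =
        (fun x ↦ gradient ψ x - V' n x) + fun x ↦ V' n x - V x := by
      ext x; simp
    rw [e]
    refine (eLpNorm_add_le ((memLp_gradient ψ 1).1.sub (hV' n)) ((hV' n).sub hV) hq).trans_lt ?_
    exact (ENNReal.add_lt_add hψ₂ hn₂).trans_eq (ENNReal.add_halves η)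

/-- Composition of a test function with a smooth function vanishing at the origin. -/
noncomputable def compTestFunction (F : ℝ → ℝ) (hF : ContDiff ℝ ∞ F) (hF0 : F 0 = 0) (φ : 𝓓(Ω, ℝ)) :
    𝓓(Ω, ℝ) where
  toFun := F ∘ φ
  contDiff' := hF.comp φ.contDiff
  hasCompactSupport' := φ.hasCompactSupport.comp_left hF0
  tsupport_subset' :=
    (closure_mono (Function.support_comp_subset hF0 φ)).trans φ.tsupport_subset

theorem gradient_compTestFunction {F : ℝ → ℝ} (hF : ContDiff ℝ ∞ F) (hF0 : F 0 = 0)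
    (φ : 𝓓(Ω, ℝ)) (x : EuclideanSpace ℝ (Fin N)) :
    gradient (compTestFunction F hF hF0 φ) x = deriv F (φ x) • gradient φ x := by
  ext i
  have hc : (compTestFunction F hF hF0 φ : EuclideanSpace ℝ (Fin N) → ℝ) = F ∘ φ := rfl
  rw [PiLp.smul_apply, gradient_apply_eq_fderiv, gradient_apply_eq_fderiv, hc,
    fderiv_comp x (hF.differentiable (by simp) _) (φ.contDiff.differentiable (by simp) x)]
  simp [mul_comm]

/-- The chain rule for limits of test functions. -/
theorem IsSobolevLimit.comp (hq : 1 ≤ q) (hq' : q ≠ ⊤)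
    (hu : AEStronglyMeasurable u (volume.restrict (Ω : Set (EuclideanSpace ℝ (Fin N)))))
    (hg : MemLp g q (volume.restrict (Ω : Set (EuclideanSpace ℝ (Fin N)))))
    (h : IsSobolevLimit Ω q u g) {F : ℝ → ℝ} (hF : ContDiff ℝ ∞ F) (hF0 : F 0 = 0) {C : ℝ}
    (hC : ∀ t, |deriv F t| ≤ C) :
    IsSobolevLimit Ω q (fun x ↦ F (u x)) (fun x ↦ deriv F (u x) • g x) := by
  have hq0 : q ≠ 0 := (zero_lt_one.trans_le hq).ne'
  obtain ⟨φ₀, h₁, h₂⟩ := h.exists_seq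
  -- An a.e. convergent subsequence is needed for `F'(φₙ) → F'(u)` pointwise.
  obtain ⟨ns, hns, hae⟩ := (tendstoInMeasure_of_tendsto_eLpNorm hq0
    (fun n ↦ (memLp_testFunction (φ₀ n) 1).1) hu h₁).exists_seq_tendsto_ae
  have h₁' := h₁.comp hns.tendsto_atTop
  have h₂' := h₂.comp hns.tendsto_atTop
  set φ := fun n ↦ φ₀ (ns n)
  have hF' : Continuous (deriv F) := hF.continuous_deriv (by simp)
  have hCtop : ENNReal.ofReal C ≠ ⊤ := ENNReal.ofReal_ne_top
  refine isSobolevLimit_of_tendsto (φ := fun n ↦ compTestFunction F hF hF0 (φ n)) ?_ ?_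
  · have hlim := ENNReal.Tendsto.const_mul (a := ENNReal.ofReal C) h₁' (Or.inr hCtop)
    rw [mul_zero] at hlim
    refine tendsto_of_tendsto_of_tendsto_of_le_of_le tendsto_const_nhds hlim
      (fun _ ↦ zero_le) fun n ↦ eLpNorm_le_mul_eLpNorm_of_ae_le_mul (ae_of_all _ fun x ↦ ?_) q
    exact Convex.norm_image_sub_le_of_norm_deriv_le (s := Set.univ)
      (fun t _ ↦ hF.differentiable (by simp) t) (fun t _ ↦ hC t) convex_univ
      (Set.mem_univ _) (Set.mem_univ _)
  · have hlim := ENNReal.Tendsto.const_mul (a := ENNReal.ofReal C) h₂' (Or.inr hCtop)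
    rw [mul_zero] at hlim
    have hm : ∀ n, AEStronglyMeasurable (fun x ↦ deriv F (φ n x) - deriv F (u x))
        (volume.restrict (Ω : Set (EuclideanSpace ℝ (Fin N)))) := fun n ↦
      (hF'.comp_aestronglyMeasurable (memLp_testFunction (φ n) 1).1).sub
        (hF'.comp_aestronglyMeasurable hu)
    -- The error in the gradient is `F'(φₙ)(∇φₙ - g) + (F'(φₙ) - F'(u)) g`. The first term is
    -- controlled by `C`, the second by dominated convergence with bound `2C|g|`.
    have hdom : Tendsto (fun n ↦ eLpNorm (fun x ↦ (deriv F (φ n x) - deriv F (u x)) • g x) q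
        (volume.restrict (Ω : Set (EuclideanSpace ℝ (Fin N))))) atTop (𝓝 0) := by
      refine tendsto_eLpNorm_zero_of_dominated hq0 hq' (fun n ↦ (hm n).smul hg.1)
        (b := fun x ↦ (2 * C) * ‖g x‖) (hg.norm.const_mul _)
        (fun n ↦ ae_of_all _ fun x ↦ ?_) ?_
      · rw [norm_smul]
        gcongr
        calc ‖deriv F (φ n x) - deriv F (u x)‖ ≤ |deriv F (φ n x)| + |deriv F (u x)| :=
              norm_sub_le _ _
          _ ≤ 2 * C := by linarith [hC (φ n x), hC (u x)]
      · filter_upwards [hae] with x hx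
        have := (((hF'.tendsto (u x)).comp hx).sub_const (deriv F (u x))).smul_const (g x)
        simpa using this
    refine tendsto_of_tendsto_of_tendsto_of_le_of_le tendsto_const_nhds
      (by simpa using hlim.add hdom) (fun _ ↦ zero_le) fun n ↦ ?_
    have e : (fun x ↦ gradient (compTestFunction F hF hF0 (φ n)) x - deriv F (u x) • g x) =
        (fun x ↦ deriv F (φ n x) • (gradient (φ n) x - g x)) +
          fun x ↦ (deriv F (φ n x) - deriv F (u x)) • g x := by
      ext1 x
      simp only [gradient_compTestFunction, Pi.add_apply, smul_sub, sub_smul]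
      abel
    simp only [e]
    refine (eLpNorm_add_le ((hF'.comp_aestronglyMeasurable (memLp_testFunction (φ n) 1).1).smul
      ((memLp_gradient (φ n) 1).1.sub hg.1)) ((hm n).smul hg.1) hq).trans ?_
    refine add_le_add ?_ le_rfl
    refine eLpNorm_le_mul_eLpNorm_of_ae_le_mul (ae_of_all _ fun x ↦ ?_) q
    refine (norm_smul_le (deriv F (φ n x)) (gradient (φ n) x - g x)).trans ?_
    gcongr
    exact hC _

/-! ### Regularised powers -/

/-- A smooth approximation of `|t|^γ` with bounded derivative. -/
noncomputable def smoothPow (γ ε t : ℝ) : ℝ :=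
  (t ^ 2 + ε) ^ (γ / 2) / (1 + ε * (t ^ 2 + ε) ^ (γ / 2)) -
    ε ^ (γ / 2) / (1 + ε * ε ^ (γ / 2))

section smoothPow

variable {γ ε t : ℝ}

theorem smoothPow_zero : smoothPow γ ε 0 = 0 := by simp [smoothPow]

theorem contDiff_smoothPow (hε : 0 < ε) : ContDiff ℝ ∞ (smoothPow γ ε) := by
  have h : ContDiff ℝ ∞ fun t : ℝ ↦ (t ^ 2 + ε) ^ (γ / 2) :=
    ((contDiff_id.pow 2).add contDiff_const).rpow_const_of_ne fun t ↦ by positivity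
  exact (h.div (contDiff_const.add (contDiff_const.mul h)) fun t ↦ by positivity).sub
    contDiff_const

theorem deriv_smoothPow (hε : 0 < ε) (t : ℝ) :
    deriv (smoothPow γ ε) t =
      γ * t * (t ^ 2 + ε) ^ (γ / 2 - 1) / (1 + ε * (t ^ 2 + ε) ^ (γ / 2)) ^ 2 := by
  have hpos : 0 < t ^ 2 + ε := by positivity
  have h : HasDerivAt (fun t : ℝ ↦ (t ^ 2 + ε) ^ (γ / 2))
      (γ * t * (t ^ 2 + ε) ^ (γ / 2 - 1)) t := by
    have := (((hasDerivAt_id' t).fun_pow 2).add_const ε).rpow_const (p := γ / 2) (Or.inl hpos.ne')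
    convert this using 1
    simp only [Nat.cast_ofNat, Nat.add_one_sub_one, pow_one, mul_one]
    ring
  have hd := (h.div ((h.const_mul ε).const_add 1) (by positivity)).sub_const
    (ε ^ (γ / 2) / (1 + ε * ε ^ (γ / 2)))
  refine hd.deriv.trans ?_
  congr 1
  ring

theorem rpow_sq_add_le (hε : 0 ≤ ε) (hε1 : ε ≤ 1) {β : ℝ} (hβ : 0 ≤ β) (t : ℝ) :
    (t ^ 2 + ε) ^ (β / 2) ≤ (1 + |t|) ^ β := by
  have h : t ^ 2 + ε ≤ (1 + |t|) ^ (2 : ℝ) := by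
    rw [Real.rpow_two]
    nlinarith [sq_abs t, abs_nonneg t]
  calc (t ^ 2 + ε) ^ (β / 2) ≤ ((1 + |t|) ^ (2 : ℝ)) ^ (β / 2) :=
        Real.rpow_le_rpow (by positivity) h (by positivity)
    _ = (1 + |t|) ^ β := by
        rw [← Real.rpow_mul (by positivity)]
        congr 1; ring

theorem abs_mul_rpow_le (hε : 0 < ε) (t : ℝ) :
    |t| * (t ^ 2 + ε) ^ (γ / 2 - 1) ≤ (t ^ 2 + ε) ^ ((γ - 1) / 2) := by
  have hpos : 0 < t ^ 2 + ε := by positivity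
  have h : |t| ≤ (t ^ 2 + ε) ^ (1 / 2 : ℝ) := by
    rw [← Real.sqrt_eq_rpow]
    exact Real.abs_le_sqrt (by linarith)
  calc |t| * (t ^ 2 + ε) ^ (γ / 2 - 1) ≤
        (t ^ 2 + ε) ^ (1 / 2 : ℝ) * (t ^ 2 + ε) ^ (γ / 2 - 1) := by gcongr
    _ = _ := by
        rw [← Real.rpow_add hpos]
        congr 1; ring

theorem abs_deriv_smoothPow_le (hγ : 1 ≤ γ) (hε : 0 < ε) (t : ℝ) :
    |deriv (smoothPow γ ε) t| ≤
      γ * (t ^ 2 + ε) ^ ((γ - 1) / 2) / (1 + ε * (t ^ 2 + ε) ^ (γ / 2)) ^ 2 := by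
  have hpos : 0 < t ^ 2 + ε := by positivity
  rw [deriv_smoothPow hε, abs_div, abs_of_nonneg (sq_nonneg (1 + ε * _)), abs_mul, abs_mul,
    abs_of_nonneg (by linarith : 0 ≤ γ), abs_of_nonneg (Real.rpow_nonneg hpos.le _), mul_assoc]
  gcongr
  exact abs_mul_rpow_le hε t

/-- Uniform in `ε`: this is the domination used when `ε → 0`. -/
theorem abs_deriv_smoothPow_le_rpow (hγ : 1 ≤ γ) (hε : 0 < ε) (hε1 : ε ≤ 1) (t : ℝ) :
    |deriv (smoothPow γ ε) t| ≤ γ * (1 + |t|) ^ (γ - 1) := by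
  refine (abs_deriv_smoothPow_le hγ hε t).trans ?_
  have hpos : 0 ≤ (t ^ 2 + ε) ^ (γ / 2) := by positivity
  refine (div_le_self (by positivity) (one_le_pow₀ (by nlinarith))).trans ?_
  gcongr
  exact rpow_sq_add_le hε.le hε1 (by linarith) t

/-- The purpose of the denominator in `smoothPow`: for fixed `ε` the derivative is bounded, as the
chain rule requires. The bound may blow up as `ε → 0`. -/
theorem abs_deriv_smoothPow_le_const (hγ : 1 ≤ γ) (hε : 0 < ε) (hε1 : ε ≤ 1) (t : ℝ) :
    |deriv (smoothPow γ ε) t| ≤ γ / ε := by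
  refine (abs_deriv_smoothPow_le hγ hε t).trans ?_
  have hpos : 0 < t ^ 2 + ε := by positivity
  set Q := (t ^ 2 + ε) ^ (γ / 2) with hQ
  have hQ0 : 0 ≤ Q := by positivity
  -- A power with exponent between 0 and `γ/2` is at most 1 or at most `Q`, according to whether the
  -- base is below or above 1.
  have h : (t ^ 2 + ε) ^ ((γ - 1) / 2) ≤ 1 + Q := by
    rcases le_total (t ^ 2 + ε) 1 with h1 | h1
    · linarith [Real.rpow_le_one hpos.le h1 (by linarith : 0 ≤ (γ - 1) / 2)]
    · linarith [Real.rpow_le_rpow_of_exponent_le h1 (by linarith : (γ - 1) / 2 ≤ γ / 2)]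
  have h2 : 1 ≤ 1 + ε * Q := by nlinarith
  rw [div_le_div_iff₀ (by positivity) hε]
  have h3 : (t ^ 2 + ε) ^ ((γ - 1) / 2) * ε ≤ (1 + ε * Q) ^ 2 := by nlinarith
  nlinarith

/-- Each of the three terms involved lies between 0 and `(1+|t|)^γ`. -/
theorem abs_smoothPow_sub_le (hγ : 0 ≤ γ) (hε : 0 < ε) (hε1 : ε ≤ 1) (t : ℝ) :
    |smoothPow γ ε t - |t| ^ γ| ≤ 3 * (1 + |t|) ^ γ := by
  have key : ∀ y : ℝ, 0 ≤ y → 0 ≤ y / (1 + ε * y) ∧ y / (1 + ε * y) ≤ y := fun y hy ↦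
    ⟨by positivity, div_le_self hy (by nlinarith)⟩
  obtain ⟨a1, a2⟩ := key ((t ^ 2 + ε) ^ (γ / 2)) (by positivity)
  obtain ⟨b1, b2⟩ := key (ε ^ (γ / 2)) (by positivity)
  have c1 : ε ^ (γ / 2) ≤ (t ^ 2 + ε) ^ (γ / 2) := by
    gcongr; nlinarith [sq_nonneg t]
  have c2 := rpow_sq_add_le hε.le hε1 hγ t
  have c3 : |t| ^ γ ≤ (1 + |t|) ^ γ := by gcongr; linarith
  have c4 : 0 ≤ |t| ^ γ := by positivity
  rw [smoothPow, abs_le]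
  constructor <;> linarith

theorem rpow_sq_half (t γ : ℝ) : (t ^ 2) ^ (γ / 2) = |t| ^ γ := by
  rw [← sq_abs, ← Real.rpow_two, ← Real.rpow_mul (abs_nonneg t)]
  congr 1; ring

/-- At `t = 0` with `γ = 1` the left side is 0 while the right side is `0^0 = 1`, hence the
exclusion. -/
theorem abs_mul_rpow_sq (hγ : γ ≠ 1) (t : ℝ) :
    |t| * (t ^ 2) ^ (γ / 2 - 1) = |t| ^ (γ - 1) := by
  rcases eq_or_ne t 0 with rfl | ht
  · simp [Real.zero_rpow (sub_ne_zero.2 hγ)]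
  · have e : γ / 2 - 1 = (γ - 2) / 2 := by ring
    have hp : 0 < |t| := abs_pos.2 ht
    rw [e, rpow_sq_half]
    nth_rewrite 1 [← Real.rpow_one |t|]
    rw [← Real.rpow_add hp]
    congr 1; ring

theorem tendsto_sq_add_rpow (t : ℝ) {β : ℝ} (h : t ≠ 0 ∨ 0 < β) {e : ℕ → ℝ}
    (he : Tendsto e atTop (𝓝 0)) :
    Tendsto (fun n ↦ (t ^ 2 + e n) ^ β) atTop (𝓝 ((t ^ 2) ^ β)) := by
  have h1 : Tendsto (fun n ↦ t ^ 2 + e n) atTop (𝓝 (t ^ 2)) := by simpa using he.const_add (t ^ 2)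
  exact h1.rpow_const (h.imp (fun h ↦ by positivity) le_of_lt)

theorem tendsto_smoothPow (hγ : 0 < γ) {e : ℕ → ℝ} (he : Tendsto e atTop (𝓝 0)) (t : ℝ) :
    Tendsto (fun n ↦ smoothPow γ (e n) t) atTop (𝓝 (|t| ^ γ)) := by
  have h : ∀ t : ℝ, Tendsto (fun n ↦ (t ^ 2 + e n) ^ (γ / 2) /
      (1 + e n * (t ^ 2 + e n) ^ (γ / 2))) atTop (𝓝 (|t| ^ γ)) := by
    intro t
    have h1 := tendsto_sq_add_rpow t (Or.inr (half_pos hγ)) he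
    have := h1.div ((he.mul h1).const_add 1) (by simp)
    rw [rpow_sq_half, zero_mul, add_zero, div_one] at this
    exact this
  have := (h t).sub (h 0)
  simpa [smoothPow, Real.zero_rpow hγ.ne'] using this

theorem tendsto_deriv_smoothPow (hγ : 0 < γ) {e : ℕ → ℝ} (he0 : ∀ n, 0 < e n)
    (he : Tendsto e atTop (𝓝 0)) (t : ℝ) :
    Tendsto (fun n ↦ deriv (smoothPow γ (e n)) t) atTop
      (𝓝 (γ * t * (t ^ 2) ^ (γ / 2 - 1))) := by
  simp_rw [fun n ↦ deriv_smoothPow (γ := γ) (he0 n) t]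
  rcases eq_or_ne t 0 with rfl | ht
  · simp
  · have h1 := tendsto_sq_add_rpow t (Or.inr (half_pos hγ)) he
    have h2 := tendsto_sq_add_rpow t (β := γ / 2 - 1) (Or.inl ht) he
    have := (h2.const_mul (γ * t)).div (((he.mul h1).const_add 1).pow 2) (by simp)
    rw [zero_mul, add_zero, one_pow, div_one] at this
    exact this

end smoothPow

/-! ### Powers of Sobolev functions -/

variable {p r : ℝ}

theorem memLp_one_add_abs_rpow {α : Type*} [MeasurableSpace α] {μ : Measure α} [IsFiniteMeasure μ]
    {u : α → ℝ} {β : ℝ} (hβ : 0 < β) (hu : MemLp u (ENNReal.ofReal p) μ) :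
    MemLp (fun x ↦ (1 + |u x|) ^ β) (ENNReal.ofReal (p / β)) μ := by
  have h1 : MemLp (fun x ↦ 1 + |u x|) (ENNReal.ofReal p) μ :=
    MemLp.add (f := fun _ ↦ (1 : ℝ)) (g := fun x ↦ |u x|) (memLp_const 1) hu.abs
  have h2 := h1.norm_rpow_div (ENNReal.ofReal β)
  rw [← ENNReal.ofReal_div_of_pos hβ, ENNReal.toReal_ofReal hβ.le] at h2
  refine h2.congr_norm ?_ (ae_of_all _ fun x ↦ ?_)
  · exact (h1.1.aemeasurable.pow_const β).aestronglyMeasurable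
  · rw [Real.norm_of_nonneg (r := 1 + |u x|) (by positivity)]

/-- Hölder's inequality with `(p/r - 1)/p + 1/p = 1/r`. -/
theorem memLp_rpow_mul_norm {α F : Type*} [MeasurableSpace α] {μ : Measure α} [IsFiniteMeasure μ]
    [NormedAddCommGroup F] {u : α → ℝ} {g : α → F} (hr : 0 < r) (hrp : r < p)
    (hu : MemLp u (ENNReal.ofReal p) μ) (hg : MemLp g (ENNReal.ofReal p) μ) :
    MemLp (fun x ↦ (1 + |u x|) ^ (p / r - 1) * ‖g x‖) (ENNReal.ofReal r) μ := by
  have hp : 0 < p := hr.trans hrp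
  have hβ : 0 < p / r - 1 := by rw [sub_pos, one_lt_div hr]; exact hrp
  have h1 := memLp_one_add_abs_rpow hβ hu
  have : ENNReal.HolderTriple (ENNReal.ofReal (p / (p / r - 1))) (ENNReal.ofReal p)
      (ENNReal.ofReal r) := by
    constructor
    rw [← ENNReal.ofReal_inv_of_pos (by positivity), ← ENNReal.ofReal_inv_of_pos hp,
      ← ENNReal.ofReal_inv_of_pos hr, ← ENNReal.ofReal_add (by positivity) (by positivity)]
    congr 1
    field_simp
    ring
  exact hg.norm.mul h1

/-- The power `|u|^{p/r}` of a limit of test functions is again such a limit. -/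
theorem IsSobolevLimit.abs_rpow
    [IsFiniteMeasure (volume.restrict (Ω : Set (EuclideanSpace ℝ (Fin N))))]
    (hr : 1 ≤ r) (hrp : r < p)
    (hu : MemLp u (ENNReal.ofReal p) (volume.restrict (Ω : Set (EuclideanSpace ℝ (Fin N)))))
    (hg : MemLp g (ENNReal.ofReal p) (volume.restrict (Ω : Set (EuclideanSpace ℝ (Fin N)))))
    (h : IsSobolevLimit Ω (ENNReal.ofReal r) u g) :
    IsSobolevLimit Ω (ENNReal.ofReal r) (fun x ↦ |u x| ^ (p / r))
      (fun x ↦ (p / r * u x * (u x ^ 2) ^ (p / r / 2 - 1)) • g x) := by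
  have hr0 : 0 < r := by linarith
  have hγ : 1 < p / r := by rw [one_lt_div hr0]; exact hrp
  have hbase := memLp_one_add_abs_rpow (by linarith) hu (β := p / r)
  have hgrad := memLp_rpow_mul_norm hr0 hrp hu hg
  rw [div_div_cancel₀ (by linarith)] at hbase
  generalize p / r = γ at *
  have hq : (1 : ℝ≥0∞) ≤ ENNReal.ofReal r := by simpa using ENNReal.ofReal_le_ofReal hr
  have hq0 : ENNReal.ofReal r ≠ 0 := by simpa using hr0
  have hq' : ENNReal.ofReal r ≠ ⊤ := ENNReal.ofReal_ne_top
  let e : ℕ → ℝ := fun n ↦ 1 / ((n : ℝ) + 1)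
  have he0 : ∀ n, 0 < e n := fun n ↦ Nat.one_div_pos_of_nat
  have he1 : ∀ n, e n ≤ 1 := fun n ↦ by
    have : (0 : ℝ) ≤ n := by positivity
    exact div_le_one_of_le₀ (by linarith) (by linarith)
  have he : Tendsto e atTop (𝓝 0) := tendsto_one_div_add_atTop_nhds_zero_nat
  have hcd : ∀ n, ContDiff ℝ ∞ (smoothPow γ (e n)) := fun n ↦ contDiff_smoothPow (he0 n)
  have hm₁ : ∀ n, AEStronglyMeasurable (fun x ↦ smoothPow γ (e n) (u x))
      (volume.restrict (Ω : Set (EuclideanSpace ℝ (Fin N)))) := fun n ↦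
    (hcd n).continuous.comp_aestronglyMeasurable hu.1
  have hm₂ : ∀ n, AEStronglyMeasurable (fun x ↦ deriv (smoothPow γ (e n)) (u x) • g x)
      (volume.restrict (Ω : Set (EuclideanSpace ℝ (Fin N)))) := fun n ↦
    (((hcd n).continuous_deriv (by simp)).comp_aestronglyMeasurable hu.1).smul hg.1
  have hm₃ : AEStronglyMeasurable (fun x ↦ |u x| ^ γ)
      (volume.restrict (Ω : Set (EuclideanSpace ℝ (Fin N)))) :=
    (hu.abs.1.aemeasurable.pow_const γ).aestronglyMeasurable
  have hm₄ : AEStronglyMeasurable (fun x ↦ (γ * u x * (u x ^ 2) ^ (γ / 2 - 1)) • g x)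
      (volume.restrict (Ω : Set (EuclideanSpace ℝ (Fin N)))) := by
    have := hu.1.aemeasurable
    exact (((this.const_mul γ).mul ((this.pow_const 2).pow_const _)).aestronglyMeasurable).smul hg.1
  -- The chain rule applies at each fixed `e n`; the regularisation is then removed by dominated
  -- convergence.
  refine IsSobolevLimit.of_tendsto hq hm₁ hm₂ hm₃ hm₄
    (fun n ↦ h.comp hq hq' hu.1 (hg.mono_exponent (ENNReal.ofReal_le_ofReal hrp.le)) (hcd n)
      smoothPow_zero (abs_deriv_smoothPow_le_const hγ.le (he0 n) (he1 n))) ?_ ?_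
  · refine tendsto_eLpNorm_zero_of_dominated hq0 hq' (fun n ↦ (hm₁ n).sub hm₃)
      (hbase.const_mul 3) (fun n ↦ ae_of_all _ fun x ↦
        abs_smoothPow_sub_le (by linarith) (he0 n) (he1 n) (u x)) (ae_of_all _ fun x ↦ ?_)
    have := (tendsto_smoothPow (γ := γ) (by linarith) he (u x)).sub_const (|u x| ^ γ)
    rwa [sub_self] at this
  · refine tendsto_eLpNorm_zero_of_dominated hq0 hq' (fun n ↦ (hm₂ n).sub hm₄)
      -- The derivative and its limit are each at most `γ(1+|u|)^{γ-1}`.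
      (hgrad.const_mul (2 * γ)) (fun n ↦ ae_of_all _ fun x ↦ ?_) (ae_of_all _ fun x ↦ ?_)
    · rw [← sub_smul, norm_smul, ← mul_assoc]
      gcongr
      have h1 := abs_deriv_smoothPow_le_rpow hγ.le (he0 n) (he1 n) (u x)
      have h2 : |γ * u x * (u x ^ 2) ^ (γ / 2 - 1)| ≤ γ * (1 + |u x|) ^ (γ - 1) := by
        rw [abs_mul, abs_mul, abs_of_nonneg (by linarith : 0 ≤ γ),
          abs_of_nonneg (Real.rpow_nonneg (sq_nonneg (u x)) _), mul_assoc,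
          abs_mul_rpow_sq hγ.ne']
        gcongr
        linarith
      rw [Real.norm_eq_abs]
      linarith [abs_sub (deriv (smoothPow γ (e n)) (u x)) (γ * u x * (u x ^ 2) ^ (γ / 2 - 1))]
    · have := ((tendsto_deriv_smoothPow (γ := γ) (by linarith) he0 he (u x)).sub_const
        (γ * u x * (u x ^ 2) ^ (γ / 2 - 1))).smul_const (g x)
      rw [sub_self, zero_smul] at this
      simpa only [sub_smul] using this

end PLaplace

/-! ### Rayleigh quotients and the eigenvalue inequality -/

namespace PLaplace

open scoped ENNReal ContDiff

theorem tendsto_eLpNorm_of_tendsto_sub {α F : Type*} [MeasurableSpace α] [NormedAddCommGroup F]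
    {μ : Measure α} {q : ℝ≥0∞} (hq : 1 ≤ q) {f : ℕ → α → F} {f₀ : α → F}
    (hf : ∀ n, AEStronglyMeasurable (f n) μ) (hf₀ : AEStronglyMeasurable f₀ μ)
    (h : Tendsto (fun n ↦ eLpNorm (fun x ↦ f n x - f₀ x) q μ) atTop (𝓝 0)) :
    Tendsto (fun n ↦ eLpNorm (f n) q μ) atTop (𝓝 (eLpNorm f₀ q μ)) := by
  have hlow : Tendsto (fun n ↦ eLpNorm f₀ q μ - eLpNorm (fun x ↦ f n x - f₀ x) q μ) atTop
      (𝓝 (eLpNorm f₀ q μ - 0)) :=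
    ENNReal.Tendsto.sub tendsto_const_nhds h (Or.inr ENNReal.zero_ne_top)
  have hup := (tendsto_const_nhds (x := eLpNorm f₀ q μ)).add h
  rw [tsub_zero] at hlow
  rw [add_zero] at hup
  refine tendsto_of_tendsto_of_tendsto_of_le_of_le hlow hup (fun n ↦ ?_) fun n ↦ ?_
  · rw [tsub_le_iff_right]
    have e : f₀ = f n - fun x ↦ f n x - f₀ x := by ext x; simp
    calc eLpNorm f₀ q μ = eLpNorm (f n - fun x ↦ f n x - f₀ x) q μ := by rw [← e]
      _ ≤ _ := eLpNorm_sub_le (hf n) ((hf n).sub hf₀) hq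
  · have e : f n = f₀ + fun x ↦ f n x - f₀ x := by ext x; simp
    calc eLpNorm (f n) q μ = eLpNorm (f₀ + fun x ↦ f n x - f₀ x) q μ := by rw [← e]
      _ ≤ _ := eLpNorm_add_le hf₀ ((hf n).sub hf₀) hq

theorem integrable_norm_rpow {α F : Type*} [MeasurableSpace α] {μ : Measure α}
    [NormedAddCommGroup F] {u : α → F} {p : ℝ}
    (hp : 0 < p) (hu : MemLp u (ENNReal.ofReal p) μ) : Integrable (fun x ↦ ‖u x‖ ^ p) μ := by
  have := hu.norm_rpow (by simpa using hp) ENNReal.ofReal_ne_top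
  rw [ENNReal.toReal_ofReal hp.le] at this
  exact memLp_one_iff_integrable.1 this

theorem integral_abs_rpow_pos {α : Type*} [MeasurableSpace α] {μ : Measure α} {u : α → ℝ} {p : ℝ}
    (hp : 0 < p) (hu : MemLp u (ENNReal.ofReal p) μ) (h0 : ¬ u =ᵐ[μ] 0) :
    0 < ∫ x, |u x| ^ p ∂μ := by
  have hint : Integrable (fun x ↦ |u x| ^ p) μ := integrable_norm_rpow hp hu
  refine lt_of_le_of_ne (integral_nonneg fun x ↦ by positivity) fun h ↦ h0 ?_
  have := (integral_eq_zero_iff_of_nonneg (fun x ↦ by positivity) hint).1 h.symm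
  filter_upwards [this] with x hx
  have hx' : |u x| ^ p = 0 := hx
  simpa using (Real.rpow_eq_zero (abs_nonneg _) hp.ne').1 hx'

variable {N : ℕ} {Ω : Opens (EuclideanSpace ℝ (Fin N))} {q : ℝ≥0∞}
  {u v : EuclideanSpace ℝ (Fin N) → ℝ}
  {g V : EuclideanSpace ℝ (Fin N) → EuclideanSpace ℝ (Fin N)} {p r s : ℝ}

theorem nonneg_of_mem_rayleighQuotients {P : (EuclideanSpace ℝ (Fin N) → ℝ) → Prop} {t : ℝ}
    (ht : t ∈ rayleighQuotients Ω p P) : 0 ≤ t := by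
  obtain ⟨u, g, -, -, -, rfl⟩ := ht
  exact div_nonneg (integral_nonneg fun x ↦ by positivity) (integral_nonneg fun x ↦ by positivity)

theorem bddBelow_rayleighQuotients (P : (EuclideanSpace ℝ (Fin N) → ℝ) → Prop) :
    BddBelow (rayleighQuotients Ω p P) :=
  ⟨0, fun _ ht ↦ nonneg_of_mem_rayleighQuotients ht⟩

theorem firstEigenvalue_nonneg : 0 ≤ firstEigenvalue Ω p :=
  Real.sInf_nonneg fun _ ht ↦ nonneg_of_mem_rayleighQuotients ht

theorem firstEigenvalueMinus_nonneg : 0 ≤ firstEigenvalueMinus Ω p :=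
  Real.sInf_nonneg fun _ ht ↦ nonneg_of_mem_rayleighQuotients ht

theorem rayleighQuotients_subset
    [IsFiniteMeasure (volume.restrict (Ω : Set (EuclideanSpace ℝ (Fin N))))] :
    rayleighQuotients Ω p (MemW10 Ω p) ⊆ rayleighQuotients Ω p (MemW10Minus Ω p) := by
  rintro t ⟨u, g, hu, h⟩
  exact ⟨u, g, hu.memW10Minus, h⟩

/-- A bump function gives a quotient, so the infimum is not the default value of `sInf` on the empty
set. -/
theorem rayleighQuotients_nonempty (hΩ : (Ω : Set (EuclideanSpace ℝ (Fin N))).Nonempty) :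
    (rayleighQuotients Ω p (MemW10 Ω p)).Nonempty := by
  obtain ⟨x, hx⟩ := hΩ
  obtain ⟨f, hfs, hfc, hf, -, hfx⟩ := exists_contDiff_tsupport_subset (n := ⊤)
    (Ω.isOpen.mem_nhds hx)
  let φ : 𝓓(Ω, ℝ) := ⟨f, hf, hfc, hfs⟩
  refine ⟨_, φ, gradient φ, memW10_testFunction φ p, hasWeakGradient_testFunction φ, fun h ↦ ?_,
    rfl⟩
  have h0 := Measure.eqOn_open_of_ae_eq h Ω.isOpen φ.continuous.continuousOn continuousOn_const hx
  have : f x = 0 := h0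
  simp [hfx] at this

theorem firstEigenvalueMinus_le
    [IsFiniteMeasure (volume.restrict (Ω : Set (EuclideanSpace ℝ (Fin N))))]
    (hΩ : (Ω : Set (EuclideanSpace ℝ (Fin N))).Nonempty) :
    firstEigenvalueMinus Ω p ≤ firstEigenvalue Ω p :=
  csInf_le_csInf (bddBelow_rayleighQuotients _) (rayleighQuotients_nonempty hΩ)
    rayleighQuotients_subset

theorem firstEigenvalue_mul_le_testFunction (hp : 0 < p) (φ : 𝓓(Ω, ℝ)) :
    firstEigenvalue Ω p * ∫ x in (Ω : Set (EuclideanSpace ℝ (Fin N))), |φ x| ^ p ≤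
      ∫ x in (Ω : Set (EuclideanSpace ℝ (Fin N))), ‖gradient φ x‖ ^ p := by
  by_cases h : φ =ᵐ[volume.restrict (Ω : Set (EuclideanSpace ℝ (Fin N)))] 0
  · have e : ∫ x in (Ω : Set (EuclideanSpace ℝ (Fin N))), |φ x| ^ p = 0 := by
      refine integral_eq_zero_of_ae ?_
      filter_upwards [h] with x hx
      simp [hx, Real.zero_rpow hp.ne']
    rw [e, mul_zero]
    exact integral_nonneg fun x ↦ by positivity
  · rw [← le_div_iff₀ (integral_abs_rpow_pos hp (memLp_testFunction φ _) h)]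
    exact csInf_le (bddBelow_rayleighQuotients _)
      ⟨φ, gradient φ, memW10_testFunction φ p, hasWeakGradient_testFunction φ, h, rfl⟩

theorem tendsto_integral_norm_rpow {α F : Type*} [MeasurableSpace α] [NormedAddCommGroup F]
    {μ : Measure α} (hp : 1 ≤ p) {f : ℕ → α → F} {f₀ : α → F}
    (hf : ∀ n, MemLp (f n) (ENNReal.ofReal p) μ) (hf₀ : MemLp f₀ (ENNReal.ofReal p) μ)
    (h : Tendsto (fun n ↦ eLpNorm (fun x ↦ f n x - f₀ x) (ENNReal.ofReal p) μ) atTop (𝓝 0)) :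
    Tendsto (fun n ↦ ∫ x, ‖f n x‖ ^ p ∂μ) atTop (𝓝 (∫ x, ‖f₀ x‖ ^ p ∂μ)) := by
  have hp0 : 0 < p := by linarith
  have hq : (1 : ℝ≥0∞) ≤ ENNReal.ofReal p := by simpa using ENNReal.ofReal_le_ofReal hp
  have key : ∀ {k : α → F}, MemLp k (ENNReal.ofReal p) μ →
      ∫ x, ‖k x‖ ^ p ∂μ = (eLpNorm k (ENNReal.ofReal p) μ).toReal ^ p := by
    intro k hk
    have h0 : 0 ≤ ∫ x, ‖k x‖ ^ p ∂μ := integral_nonneg fun x ↦ by positivity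
    rw [hk.eLpNorm_eq_integral_rpow_norm (by simpa using hp0) ENNReal.ofReal_ne_top,
      ENNReal.toReal_ofReal hp0.le, ENNReal.toReal_ofReal (by positivity),
      Real.rpow_inv_rpow h0 hp0.ne']
  simp_rw [fun n ↦ key (hf n), key hf₀]
  exact ((ENNReal.tendsto_toReal hf₀.2.ne).comp
    (tendsto_eLpNorm_of_tendsto_sub hq (fun n ↦ (hf n).1) hf₀.1 h)).rpow_const (Or.inr hp0.le)

/-- By density: the infimum is tested on test functions only, and both integrals pass to the limit.
Thus `V` never has to be identified as a weak gradient of `v`. -/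
theorem IsSobolevLimit.firstEigenvalue_mul_le (hp : 1 ≤ p)
    (hv : MemLp v (ENNReal.ofReal p) (volume.restrict (Ω : Set (EuclideanSpace ℝ (Fin N)))))
    (hV : MemLp V (ENNReal.ofReal p) (volume.restrict (Ω : Set (EuclideanSpace ℝ (Fin N)))))
    (h : IsSobolevLimit Ω (ENNReal.ofReal p) v V) :
    firstEigenvalue Ω p * ∫ x in (Ω : Set (EuclideanSpace ℝ (Fin N))), |v x| ^ p ≤
      ∫ x in (Ω : Set (EuclideanSpace ℝ (Fin N))), ‖V x‖ ^ p := by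
  obtain ⟨φ, h₁, h₂⟩ := h.exists_seq
  exact le_of_tendsto_of_tendsto'
    ((tendsto_integral_norm_rpow hp (fun n ↦ memLp_testFunction (φ n) _) hv h₁).const_mul _)
    (tendsto_integral_norm_rpow hp (fun n ↦ memLp_gradient (φ n) _) hV h₂)
    fun n ↦ firstEigenvalue_mul_le_testFunction (by linarith) (φ n)

/-! ### Exponential weights -/

/-- Integration by parts against an exponential weight. -/
theorem IsSobolevLimit.integral_exp_mul (i : Fin N) (a : ℝ) {W : ℝ}
    (hW : ∀ x ∈ (Ω : Set (EuclideanSpace ℝ (Fin N))), Real.exp (a * x i) ≤ W)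
    (hv : MemLp v 1 (volume.restrict (Ω : Set (EuclideanSpace ℝ (Fin N)))))
    (hV : MemLp V 1 (volume.restrict (Ω : Set (EuclideanSpace ℝ (Fin N)))))
    (h : IsSobolevLimit Ω 1 v V) :
    ∫ x in (Ω : Set (EuclideanSpace ℝ (Fin N))), Real.exp (a * x i) * V x i =
      - (a * ∫ x in (Ω : Set (EuclideanSpace ℝ (Fin N))), Real.exp (a * x i) * v x) := by
  obtain ⟨φ, h₁, h₂⟩ := h.exists_seq
  set w : EuclideanSpace ℝ (Fin N) → ℝ := fun x ↦ Real.exp (a * x i) with hw_def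
  have hw : ContDiff ℝ ∞ w := by
    have : ContDiff ℝ ∞ fun x : EuclideanSpace ℝ (Fin N) ↦ x i :=
      (EuclideanSpace.proj (𝕜 := ℝ) i).contDiff
    exact (contDiff_const.mul this).exp
  have hfd : ∀ x, fderiv ℝ w x (EuclideanSpace.single i 1) = a * w x := by
    intro x
    have h1 : HasFDerivAt (fun x : EuclideanSpace ℝ (Fin N) ↦ x i)
        (EuclideanSpace.proj (𝕜 := ℝ) i) x := (EuclideanSpace.proj (𝕜 := ℝ) i).hasFDerivAt
    rw [((h1.const_mul a).exp).fderiv]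
    simp [hw_def, mul_comm]
  have hae : ∀ᵐ x ∂(volume.restrict (Ω : Set (EuclideanSpace ℝ (Fin N)))), ‖w x‖ ≤ W := by
    filter_upwards [ae_restrict_mem Ω.isOpen.measurableSet] with x hx
    rw [Real.norm_of_nonneg (Real.exp_pos _).le]
    exact hW x hx
  have hWtop : ENNReal.ofReal W ≠ ⊤ := ENNReal.ofReal_ne_top
  have hint : ∀ {f : EuclideanSpace ℝ (Fin N) → ℝ},
      MemLp f 1 (volume.restrict (Ω : Set (EuclideanSpace ℝ (Fin N)))) →
      Integrable (fun x ↦ w x * f x) (volume.restrict (Ω : Set (EuclideanSpace ℝ (Fin N)))) :=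
    fun hf ↦ (memLp_one_iff_integrable.1 hf).bdd_mul
      hw.continuous.aestronglyMeasurable hae
  -- The weight is bounded on `Ω`, so weighted integrals are continuous under `L^1` convergence.
  have hlim : ∀ {f : ℕ → EuclideanSpace ℝ (Fin N) → ℝ} {f₀ : EuclideanSpace ℝ (Fin N) → ℝ},
      (∀ n, MemLp (f n) 1 (volume.restrict (Ω : Set (EuclideanSpace ℝ (Fin N))))) →
      MemLp f₀ 1 (volume.restrict (Ω : Set (EuclideanSpace ℝ (Fin N)))) →
      Tendsto (fun n ↦ eLpNorm (fun x ↦ f n x - f₀ x) 1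
        (volume.restrict (Ω : Set (EuclideanSpace ℝ (Fin N))))) atTop (𝓝 0) →
      Tendsto (fun n ↦ ∫ x in (Ω : Set (EuclideanSpace ℝ (Fin N))), w x * f n x) atTop
        (𝓝 (∫ x in (Ω : Set (EuclideanSpace ℝ (Fin N))), w x * f₀ x)) := by
    intro f f₀ hf hf₀ hff
    refine tendsto_integral_of_L1' _ (hint hf₀).1 (Eventually.of_forall fun n ↦ hint (hf n)) ?_
    have hl := ENNReal.Tendsto.const_mul (a := ENNReal.ofReal W) hff (Or.inr hWtop)
    rw [mul_zero] at hl
    refine tendsto_of_tendsto_of_tendsto_of_le_of_le tendsto_const_nhds hl (fun _ ↦ zero_le)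
      fun n ↦ eLpNorm_le_mul_eLpNorm_of_ae_le_mul ?_ 1
    filter_upwards [hae] with x hx
    simp only [Pi.sub_apply]
    rw [← mul_sub, norm_mul]
    gcongr
  have hcoord : ∀ {k : EuclideanSpace ℝ (Fin N) → EuclideanSpace ℝ (Fin N)},
      MemLp k 1 (volume.restrict (Ω : Set (EuclideanSpace ℝ (Fin N)))) →
      MemLp (fun x ↦ k x i) 1 (volume.restrict (Ω : Set (EuclideanSpace ℝ (Fin N)))) :=
    fun hk ↦ (EuclideanSpace.proj (𝕜 := ℝ) i).comp_memLp' hk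
  have hL := hlim (fun n ↦ hcoord (memLp_gradient (φ n) 1)) (hcoord hV)
    (tendsto_of_tendsto_of_tendsto_of_le_of_le tendsto_const_nhds h₂ (fun _ ↦ zero_le)
      fun n ↦ eLpNorm_mono fun x ↦ by
        simpa using PiLp.norm_apply_le (gradient (φ n) x - V x) i)
  have hR := ((hlim (fun n ↦ memLp_testFunction (φ n) 1) hv h₁).const_mul a).neg
  refine tendsto_nhds_unique (hL.congr fun n ↦ ?_) hR
  simp_rw [gradient_apply_eq_fderiv]
  rw [setIntegral_mul_fderiv_testFunction hw (φ n)]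
  simp_rw [hfd, mul_assoc]
  rw [integral_const_mul]

/-! ### Young's inequality and its defect -/

section Young

variable {A B : ℝ}

theorem rpow_mul_rpow_le_young (hs : 0 < s) (hsp : s < p) (hA : 0 ≤ A) (hB : 0 ≤ B) :
    A ^ (p - s) * B ^ s ≤ (1 - s / p) * A ^ p + s / p * B ^ p := by
  have hp : 0 < p := hs.trans hsp
  have h1 : 0 ≤ 1 - s / p := by
    rw [sub_nonneg]
    exact (div_le_one hp).2 hsp.le
  have := Real.geom_mean_le_arith_mean2_weighted h1 (by positivity : 0 ≤ s / p)
    (Real.rpow_nonneg hA p) (Real.rpow_nonneg hB p) (by ring)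
  rw [← Real.rpow_mul hA, ← Real.rpow_mul hB] at this
  convert this using 3 <;> field_simp

/-- Where `B` is much larger than `A`, the defect in Young's inequality controls `A^(p-1) B`. -/
theorem rpow_mul_le_young_defect (hs : 1 < s) (hsp : s < p) (hA : 0 ≤ A) (hB : 0 ≤ B) :
    A ^ (p - 1) * B ≤ (2 * p / s) ^ (1 / (p - s)) * A ^ p +
      2 * p / s * ((1 - s / p) * A ^ p + s / p * B ^ p - A ^ (p - s) * B ^ s) := by
  have hp : 0 < p := by linarith
  have hs0 : 0 < s := by linarith
  have hps : 0 < p - s := by linarith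
  have hd := rpow_mul_rpow_le_young hs0 hsp hA hB
  have hb : 1 ≤ 2 * p / s := by rw [le_div_iff₀ hs0]; linarith
  -- `M^{p-s} = 2p/s`, so `B ≥ M A` implies `A^{p-s}B^s ≤ (s/2p)B^p`. Half of the term `(s/p)B^p`
  -- then survives in the defect, and multiplying by `2p/s` yields at least `B^p ≥ A^{p-1}B`. When
  -- `B ≤ M A`, the first term on the right suffices.
  set M := (2 * p / s) ^ (1 / (p - s)) with hM
  have hM1 : 1 ≤ M := Real.one_le_rpow hb (by positivity)
  have hMp : M ^ (p - s) = 2 * p / s := by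
    rw [hM, ← Real.rpow_mul (by positivity), one_div_mul_cancel hps.ne', Real.rpow_one]
  have hpow : ∀ {x : ℝ}, 0 ≤ x → x ^ (p - 1) * x = x ^ p := fun {x} hx ↦ by
    rw [← Real.rpow_add_one' hx (by linarith), sub_add_cancel]
  rcases le_total B (M * A) with h | h
  · have h1 : A ^ (p - 1) * B ≤ M * A ^ p := by
      calc A ^ (p - 1) * B ≤ A ^ (p - 1) * (M * A) := by gcongr
        _ = M * (A ^ (p - 1) * A) := by ring
        _ = M * A ^ p := by rw [hpow hA]
    have h2 : 0 ≤ 2 * p / s * ((1 - s / p) * A ^ p + s / p * B ^ p - A ^ (p - s) * B ^ s) :=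
      mul_nonneg (by positivity) (by linarith)
    linarith
  · have hAB : A ≤ B := by nlinarith
    have h1 : A ^ (p - 1) * B ≤ B ^ p := by
      rw [← hpow hB]
      gcongr
      linarith
    have h2 : 2 * p / s * (A ^ (p - s) * B ^ s) ≤ B ^ p := by
      calc 2 * p / s * (A ^ (p - s) * B ^ s) = (M * A) ^ (p - s) * B ^ s := by
            rw [Real.mul_rpow (by linarith) hA, hMp, mul_assoc]
        _ ≤ B ^ (p - s) * B ^ s := by gcongr
        _ = B ^ p := by
            rw [← Real.rpow_add' hB (by linarith), sub_add_cancel]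
    have h3 : 2 * p / s * (s / p * B ^ p) = 2 * B ^ p := by field_simp
    have h4 : 0 ≤ 2 * p / s * ((1 - s / p) * A ^ p) := by
      have : 0 ≤ 1 - s / p := by
        rw [sub_nonneg]
        exact (div_le_one hp).2 hsp.le
      positivity
    have h5 : 0 ≤ M * A ^ p := by positivity
    rw [mul_sub, mul_add]
    linarith

end Young

end PLaplace

/-! ### Comparison of exponents and its strict form -/

namespace PLaplace

open scoped ENNReal ContDiff

variable {N : ℕ} {Ω : Opens (EuclideanSpace ℝ (Fin N))}
  {u : EuclideanSpace ℝ (Fin N) → ℝ}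
  {g : EuclideanSpace ℝ (Fin N) → EuclideanSpace ℝ (Fin N)} {p r s : ℝ}

theorem norm_powGradient {F : Type*} [NormedAddCommGroup F] [NormedSpace ℝ F] {γ : ℝ}
    (hγ : 1 < γ) (t : ℝ) (y : F) :
    ‖(γ * t * (t ^ 2) ^ (γ / 2 - 1)) • y‖ = γ * (|t| ^ (γ - 1) * ‖y‖) := by
  rw [norm_smul, Real.norm_eq_abs, abs_mul, abs_mul, abs_of_nonneg (by linarith : 0 ≤ γ),
    abs_of_nonneg (Real.rpow_nonneg (sq_nonneg t) _), mul_assoc γ, abs_mul_rpow_sq hγ.ne',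
    mul_assoc]

section Measure

variable {α F : Type*} [MeasurableSpace α] {μ : Measure α}
  [NormedAddCommGroup F] [NormedSpace ℝ F] {u : α → ℝ} {g : α → F}

theorem memLp_powGradient [IsFiniteMeasure μ] (hr : 0 < r) (hrp : r < p)
    (hu : MemLp u (ENNReal.ofReal p) μ)
    (hg : MemLp g (ENNReal.ofReal p) μ) :
    MemLp (fun x ↦ (p / r * u x * (u x ^ 2) ^ (p / r / 2 - 1)) • g x) (ENNReal.ofReal r) μ := by
  have hγ : 1 < p / r := by rw [one_lt_div hr]; exact hrp
  refine ((memLp_rpow_mul_norm hr hrp hu hg).const_mul (p / r)).mono' ?_ (ae_of_all _ fun x ↦ ?_)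
  · have := hu.1.aemeasurable
    exact (((this.const_mul _).mul ((this.pow_const 2).pow_const _)).aestronglyMeasurable).smul
      hg.1
  · rw [norm_powGradient hγ]
    gcongr
    linarith

theorem memLp_abs_rpow (hr : 0 < r) (hrp : r < p) (hu : MemLp u (ENNReal.ofReal p) μ) :
    MemLp (fun x ↦ |u x| ^ (p / r)) (ENNReal.ofReal r) μ := by
  have hp : 0 < p := hr.trans hrp
  have h := hu.norm_rpow_div (ENNReal.ofReal (p / r))
  rwa [← ENNReal.ofReal_div_of_pos (by positivity), ENNReal.toReal_ofReal (by positivity),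
    div_div_cancel₀ hp.ne'] at h

end Measure

/-- The comparison behind the monotonicity of `p ↦ p λ_p^{1/p}`. -/
theorem MemW10Minus.firstEigenvalue_mul_le
    [IsFiniteMeasure (volume.restrict (Ω : Set (EuclideanSpace ℝ (Fin N))))]
    (hs : 1 < s) (hsp : s < p) (hu : MemW10Minus Ω p u) (hg : HasWeakGradient Ω u g) :
    firstEigenvalue Ω s * ∫ x in (Ω : Set (EuclideanSpace ℝ (Fin N))), |u x| ^ p ≤
      (p / s) ^ s *
        ∫ x in (Ω : Set (EuclideanSpace ℝ (Fin N))), |u x| ^ (p - s) * ‖g x‖ ^ s := by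
  have hs0 : 0 < s := by linarith
  have hgL := hu.1.memLp_weakGradient hg
  have hγ : 1 < p / s := by rw [one_lt_div hs0]; exact hsp
  -- The competitor for exponent `s` is `|u|^{p/s}`.
  have h := ((hu.isSobolevLimit hg hs.le hsp).abs_rpow hs.le hsp hu.1.1 hgL).firstEigenvalue_mul_le
    hs.le (memLp_abs_rpow hs0 hsp hu.1.1) (memLp_powGradient hs0 hsp hu.1.1 hgL)
  have e₁ : ∀ x, |(|u x| ^ (p / s))| ^ s = |u x| ^ p := fun x ↦ by
    rw [abs_of_nonneg (by positivity : 0 ≤ |u x| ^ (p / s)), ← Real.rpow_mul (abs_nonneg _),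
      div_mul_cancel₀ _ hs0.ne']
  have e₂ : ∀ x, ‖(p / s * u x * (u x ^ 2) ^ (p / s / 2 - 1)) • g x‖ ^ s =
      (p / s) ^ s * (|u x| ^ (p - s) * ‖g x‖ ^ s) := fun x ↦ by
    rw [norm_powGradient hγ, Real.mul_rpow (by linarith) (by positivity),
      Real.mul_rpow (by positivity) (by positivity), ← Real.rpow_mul (abs_nonneg _), sub_mul,
      div_mul_cancel₀ _ hs0.ne', one_mul]
  simp_rw [e₁, e₂, integral_const_mul] at h
  exact h

/-- A weighted Poincaré-type inequality. -/
theorem MemW10Minus.mul_integral_exp_le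
    [IsFiniteMeasure (volume.restrict (Ω : Set (EuclideanSpace ℝ (Fin N))))]
    (hp : 1 < p) (hu : MemW10Minus Ω p u) (hg : HasWeakGradient Ω u g) (i : Fin N) (a : ℝ) {W : ℝ}
    (hW : ∀ x ∈ (Ω : Set (EuclideanSpace ℝ (Fin N))), Real.exp (a * x i) ≤ W) :
    a * ∫ x in (Ω : Set (EuclideanSpace ℝ (Fin N))), Real.exp (a * x i) * |u x| ^ p ≤
      p * ∫ x in (Ω : Set (EuclideanSpace ℝ (Fin N))),
        Real.exp (a * x i) * (|u x| ^ (p - 1) * ‖g x‖) := by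
  have hgL := hu.1.memLp_weakGradient hg
  have hv := memLp_abs_rpow zero_lt_one hp hu.1.1
  have hV := memLp_powGradient zero_lt_one hp hu.1.1 hgL
  -- Here `r = 1`: `|u|^p` itself is a limit of test functions, but only in `L^1`.
  have h := (hu.isSobolevLimit hg le_rfl hp).abs_rpow le_rfl hp hu.1.1 hgL
  rw [ENNReal.ofReal_one] at hv hV h
  have key := h.integral_exp_mul i a hW hv hV
  have hint : Integrable (fun x ↦ Real.exp (a * x i) *
      ‖(p / 1 * u x * (u x ^ 2) ^ (p / 1 / 2 - 1)) • g x‖)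
      (volume.restrict (Ω : Set (EuclideanSpace ℝ (Fin N)))) := by
    refine (memLp_one_iff_integrable.1 hV).norm.bdd_mul (c := W) ?_ ?_
    · exact ((EuclideanSpace.proj (𝕜 := ℝ) i).continuous.const_mul a).rexp.aestronglyMeasurable
    · filter_upwards [ae_restrict_mem Ω.isOpen.measurableSet] with x hx
      rw [Real.norm_of_nonneg (Real.exp_pos _).le]
      exact hW x hx
  have e : ∀ x, Real.exp (a * x i) * ‖(p / 1 * u x * (u x ^ 2) ^ (p / 1 / 2 - 1)) • g x‖ =
      p * (Real.exp (a * x i) * (|u x| ^ (p - 1) * ‖g x‖)) := fun x ↦ by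
    rw [div_one, norm_powGradient hp]
    ring
  have hle := norm_integral_le_of_norm_le (f := fun x ↦ Real.exp (a * x i) *
      ((p / 1 * u x * (u x ^ 2) ^ (p / 1 / 2 - 1)) • g x) i) hint (ae_of_all _ fun x ↦ by
    rw [norm_mul, Real.norm_of_nonneg (Real.exp_pos _).le]
    exact mul_le_mul_of_nonneg_left (PiLp.norm_apply_le _ i) (Real.exp_pos _).le)
  rw [key, norm_neg] at hle
  simp_rw [e, integral_const_mul, div_one] at hle
  exact (le_abs_self _).trans hle

/-- Quantitative strictness in Hölder's inequality: near equality is impossible. -/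
theorem exists_pos_mul_integral_le (i : Fin N)
    (hΩ : Bornology.IsBounded (Ω : Set (EuclideanSpace ℝ (Fin N)))) (hs : 1 < s) (hsp : s < p)
    {K₀ : ℝ} (hK₀ : 0 < K₀) :
    ∃ m : ℝ, 0 < m ∧ ∀ (K : ℝ) (u : EuclideanSpace ℝ (Fin N) → ℝ)
      (g : EuclideanSpace ℝ (Fin N) → EuclideanSpace ℝ (Fin N)), 0 < K → K ≤ K₀ →
      MemW10Minus Ω p u → HasWeakGradient Ω u g →
      ∫ x in (Ω : Set (EuclideanSpace ℝ (Fin N))), ‖g x‖ ^ p ≤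
        K ^ p * ∫ x in (Ω : Set (EuclideanSpace ℝ (Fin N))), |u x| ^ p →
      m * ∫ x in (Ω : Set (EuclideanSpace ℝ (Fin N))), |u x| ^ p ≤
        K * ((∫ x in (Ω : Set (EuclideanSpace ℝ (Fin N))), |u x| ^ p) -
          ∫ x in (Ω : Set (EuclideanSpace ℝ (Fin N))), |u x| ^ (p - s) * (‖g x‖ / K) ^ s) := by
  have hs0 : 0 < s := by linarith
  have hp : 1 < p := by linarith
  have hp0 : 0 < p := by linarith
  have : IsFiniteMeasure (volume.restrict (Ω : Set (EuclideanSpace ℝ (Fin N)))) :=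
    ⟨by simpa using hΩ.measure_lt_top⟩
  set M := (2 * p / s) ^ (1 / (p - s)) with hM
  have hM0 : 0 ≤ M := by positivity
  set C := 2 * p / s
  have hC0 : 0 < C := by positivity
  -- With this `a`, the term `p K M J` below is at most `(a - 1) J`, so absorbing it leaves exactly
  -- one `J`.
  set a := p * K₀ * M + 1 with ha
  have ha0 : 0 ≤ a := by positivity
  obtain ⟨R, hR⟩ := hΩ.exists_norm_le
  set W := Real.exp (a * R)
  have hW0 : 0 < W := Real.exp_pos _
  have hcoord : ∀ x ∈ (Ω : Set (EuclideanSpace ℝ (Fin N))), |a * x i| ≤ a * R := fun x hx ↦ by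
    rw [abs_mul, abs_of_nonneg ha0]
    gcongr
    exact (PiLp.norm_apply_le x i).trans (hR x hx)
  have hW : ∀ x ∈ (Ω : Set (EuclideanSpace ℝ (Fin N))), Real.exp (a * x i) ≤ W := fun x hx ↦
    Real.exp_le_exp.2 (abs_le.1 (hcoord x hx)).2
  have hW' : ∀ x ∈ (Ω : Set (EuclideanSpace ℝ (Fin N))), W⁻¹ ≤ Real.exp (a * x i) :=
    fun x hx ↦ by
    rw [← Real.exp_neg]
    exact Real.exp_le_exp.2 (abs_le.1 (hcoord x hx)).1
  -- From `W⁻¹ ∫|u|^p ≤ J ≤ p K C W ∫d`; neither `u` nor `K` enters the constant.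
  refine ⟨W⁻¹ / (p * C * W), by positivity, ?_⟩
  intro K u g hK hKK₀ hu hg hle
  have hgL := hu.1.memLp_weakGradient hg
  have hA : Integrable (fun x ↦ |u x| ^ p)
      (volume.restrict (Ω : Set (EuclideanSpace ℝ (Fin N)))) := integrable_norm_rpow hp0 hu.1.1
  have hB : Integrable (fun x ↦ (‖g x‖ / K) ^ p)
      (volume.restrict (Ω : Set (EuclideanSpace ℝ (Fin N)))) := by
    refine ((integrable_norm_rpow hp0 hgL).div_const (K ^ p)).congr (ae_of_all _ fun x ↦ ?_)
    exact (Real.div_rpow (norm_nonneg _) hK.le p).symm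
  have hBle : ∫ x in (Ω : Set (EuclideanSpace ℝ (Fin N))), (‖g x‖ / K) ^ p ≤
      ∫ x in (Ω : Set (EuclideanSpace ℝ (Fin N))), |u x| ^ p := by
    simp_rw [Real.div_rpow (norm_nonneg _) hK.le p]
    rw [integral_div, div_le_iff₀ (by positivity), mul_comm]
    exact hle
  have hY : Integrable (fun x ↦ (1 - s / p) * |u x| ^ p + s / p * (‖g x‖ / K) ^ p)
      (volume.restrict (Ω : Set (EuclideanSpace ℝ (Fin N)))) :=
    (hA.const_mul _).add (hB.const_mul _)
  have hum := hu.1.1.1.aemeasurable.norm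
  have hgm := hgL.1.norm.aemeasurable
  have hD : Integrable (fun x ↦ |u x| ^ (p - s) * (‖g x‖ / K) ^ s)
      (volume.restrict (Ω : Set (EuclideanSpace ℝ (Fin N)))) := by
    refine hY.mono' ((hum.pow_const _).mul ((hgm.div_const K).pow_const s)).aestronglyMeasurable
      (ae_of_all _ fun x ↦ ?_)
    rw [Real.norm_of_nonneg (by positivity)]
    exact rpow_mul_rpow_le_young hs0 hsp (abs_nonneg _) (by positivity)
  set d : EuclideanSpace ℝ (Fin N) → ℝ := fun x ↦
    (1 - s / p) * |u x| ^ p + s / p * (‖g x‖ / K) ^ p - |u x| ^ (p - s) * (‖g x‖ / K) ^ s with hd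
  have hd0 : ∀ x, 0 ≤ d x := fun x ↦
    sub_nonneg.2 (rpow_mul_rpow_le_young hs0 hsp (abs_nonneg _) (by positivity))
  have hdint : Integrable d (volume.restrict (Ω : Set (EuclideanSpace ℝ (Fin N)))) := hY.sub hD
  -- Since `∫B^p ≤ ∫A^p`, the convex combination of the two integrals is at most `∫A^p`.
  have hdle : ∫ x in (Ω : Set (EuclideanSpace ℝ (Fin N))), d x ≤
      (∫ x in (Ω : Set (EuclideanSpace ℝ (Fin N))), |u x| ^ p) -
        ∫ x in (Ω : Set (EuclideanSpace ℝ (Fin N))), |u x| ^ (p - s) * (‖g x‖ / K) ^ s := by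
    rw [hd, integral_sub hY hD, integral_add (hA.const_mul _) (hB.const_mul _),
      integral_const_mul, integral_const_mul]
    have : 0 ≤ s / p := by positivity
    nlinarith
  have hwm : AEStronglyMeasurable (fun x : EuclideanSpace ℝ (Fin N) ↦ Real.exp (a * x i))
      (volume.restrict (Ω : Set (EuclideanSpace ℝ (Fin N)))) :=
    ((EuclideanSpace.proj (𝕜 := ℝ) i).continuous.const_mul a).rexp.aestronglyMeasurable
  have hwb : ∀ᵐ x ∂(volume.restrict (Ω : Set (EuclideanSpace ℝ (Fin N)))),
      ‖Real.exp (a * x i)‖ ≤ W := by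
    filter_upwards [ae_restrict_mem Ω.isOpen.measurableSet] with x hx
    rw [Real.norm_of_nonneg (Real.exp_pos _).le]
    exact hW x hx
  have hwA := hA.bdd_mul hwm hwb
  have hwd := hdint.bdd_mul hwm hwb
  set J := ∫ x in (Ω : Set (EuclideanSpace ℝ (Fin N))), Real.exp (a * x i) * |u x| ^ p with hJ
  have hJ0 : 0 ≤ J := integral_nonneg fun x ↦ by positivity
  have hmain := hu.mul_integral_exp_le hp hg i a hW
  have hright : ∫ x in (Ω : Set (EuclideanSpace ℝ (Fin N))),
        Real.exp (a * x i) * (|u x| ^ (p - 1) * ‖g x‖) ≤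
      K * (M * J + C * ∫ x in (Ω : Set (EuclideanSpace ℝ (Fin N))),
        Real.exp (a * x i) * d x) := by
    rw [hJ, ← integral_const_mul M, ← integral_const_mul C,
      ← integral_add (hwA.const_mul M) (hwd.const_mul C), ← integral_const_mul K]
    refine integral_mono_of_nonneg (ae_of_all _ fun x ↦ by positivity)
      (((hwA.const_mul M).add (hwd.const_mul C)).const_mul K) (ae_of_all _ fun x ↦ ?_)
    have h := rpow_mul_le_young_defect hs hsp (abs_nonneg (u x))
      (by positivity : 0 ≤ ‖g x‖ / K)
    have hw := (Real.exp_pos (a * x i)).le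
    calc Real.exp (a * x i) * (|u x| ^ (p - 1) * ‖g x‖) =
          K * (Real.exp (a * x i) * (|u x| ^ (p - 1) * (‖g x‖ / K))) := by field_simp
      _ ≤ K * (Real.exp (a * x i) * (M * |u x| ^ p + C * d x)) := by gcongr
      _ = _ := by ring
  have hwdle : ∫ x in (Ω : Set (EuclideanSpace ℝ (Fin N))), Real.exp (a * x i) * d x ≤
      W * ∫ x in (Ω : Set (EuclideanSpace ℝ (Fin N))), d x := by
    rw [← integral_const_mul]
    refine integral_mono_ae hwd (hdint.const_mul W) ?_
    filter_upwards [ae_restrict_mem Ω.isOpen.measurableSet] with x hx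
    exact mul_le_mul_of_nonneg_right (hW x hx) (hd0 x)
  have hIJ : W⁻¹ * ∫ x in (Ω : Set (EuclideanSpace ℝ (Fin N))), |u x| ^ p ≤ J := by
    rw [← integral_const_mul]
    refine integral_mono_ae (hA.const_mul _) hwA ?_
    filter_upwards [ae_restrict_mem Ω.isOpen.measurableSet] with x hx
    exact mul_le_mul_of_nonneg_right (hW' x hx) (by positivity)
  have hJle : J ≤ p * K * C * (W * ∫ x in (Ω : Set (EuclideanSpace ℝ (Fin N))), d x) := by
    have h1 : p * (K * (M * J)) ≤ p * (K₀ * (M * J)) := by gcongr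
    have h2 : p * (K * (C * ∫ x in (Ω : Set (EuclideanSpace ℝ (Fin N))),
        Real.exp (a * x i) * d x)) ≤
        p * (K * (C * (W * ∫ x in (Ω : Set (EuclideanSpace ℝ (Fin N))), d x))) := by gcongr
    have h3 := hmain.trans (mul_le_mul_of_nonneg_left hright hp0.le)
    rw [ha] at h3
    linarith
  rw [div_mul_eq_mul_div, div_le_iff₀ (by positivity)]
  calc _ ≤ J := hIJ
    _ ≤ p * K * C * (W * ∫ x in (Ω : Set (EuclideanSpace ℝ (Fin N))), d x) := hJle
    _ ≤ p * K * C * (W * ((∫ x in (Ω : Set (EuclideanSpace ℝ (Fin N))), |u x| ^ p) -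
        ∫ x in (Ω : Set (EuclideanSpace ℝ (Fin N))), |u x| ^ (p - s) * (‖g x‖ / K) ^ s)) := by
      gcongr
    _ = _ := by ring

theorem firstEigenvalue_lt (hN : 1 ≤ N)
    (hΩ : (Ω : Set (EuclideanSpace ℝ (Fin N))).Nonempty)
    (hΩb : Bornology.IsBounded (Ω : Set (EuclideanSpace ℝ (Fin N)))) (hs : 1 < s) (hsp : s < p) :
    s * firstEigenvalue Ω s ^ (1 / s) < p * firstEigenvalueMinus Ω p ^ (1 / p) := by
  have hs0 : 0 < s := by linarith
  have hp0 : 0 < p := by linarith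
  have : IsFiniteMeasure (volume.restrict (Ω : Set (EuclideanSpace ℝ (Fin N)))) :=
    ⟨by simpa using hΩb.measure_lt_top⟩
  set L := firstEigenvalueMinus Ω p ^ (1 / p) with hL
  have hL0 : 0 ≤ L := Real.rpow_nonneg firstEigenvalueMinus_nonneg _
  have hLp : L ^ p = firstEigenvalueMinus Ω p := by
    rw [hL, ← Real.rpow_mul firstEigenvalueMinus_nonneg, one_div_mul_cancel hp0.ne', Real.rpow_one]
  -- The loss `m` is fixed before `K` decreases to `L`, with `L + 1` as an arbitrary ceiling for
  -- `K`. A coordinate direction exists because `N ≥ 1`.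
  obtain ⟨m, hm, hmK⟩ := exists_pos_mul_integral_le (Ω := Ω) ⟨0, hN⟩ hΩb hs hsp
    (by linarith : 0 < L + 1)
  have key : ∀ K, L < K → K ≤ L + 1 → m ≤ K ∧
      firstEigenvalue Ω s ≤ (p / s) ^ s * K ^ s * (1 - m / (L + 1)) := by
    intro K hLK hK1
    have hK : 0 < K := hL0.trans_lt hLK
    have hlt : sInf (rayleighQuotients Ω p (MemW10Minus Ω p)) < K ^ p := by
      change firstEigenvalueMinus Ω p < K ^ p
      rw [← hLp]
      exact Real.rpow_lt_rpow hL0 hLK hp0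
    obtain ⟨_, ⟨u, g, hu, hg, hne, rfl⟩, hR⟩ := exists_lt_of_csInf_lt
      ((rayleighQuotients_nonempty hΩ).mono rayleighQuotients_subset) hlt
    have hI := integral_abs_rpow_pos hp0 hu.1.1 hne
    have hgle := ((div_lt_iff₀ hI).1 hR).le
    have h1 := hmK K u g hK hK1 hu hg hgle
    have h2 := hu.firstEigenvalue_mul_le hs hsp hg
    set I := ∫ x in (Ω : Set (EuclideanSpace ℝ (Fin N))), |u x| ^ p
    set D := ∫ x in (Ω : Set (EuclideanSpace ℝ (Fin N))), |u x| ^ (p - s) * (‖g x‖ / K) ^ s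
      with hD
    have hD0 : 0 ≤ D := integral_nonneg fun x ↦ by positivity
    have hDK : ∫ x in (Ω : Set (EuclideanSpace ℝ (Fin N))), |u x| ^ (p - s) * ‖g x‖ ^ s =
        K ^ s * D := by
      rw [hD, ← integral_const_mul]
      congr 1
      ext x
      rw [Real.div_rpow (norm_nonneg _) hK.le]
      field_simp
    -- A negative difference would contradict `0 < m I ≤ K (I - D)`.
    have hID : 0 ≤ I - D := by
      by_contra! hneg
      nlinarith [mul_pos hm hI, mul_neg_of_pos_of_neg hK hneg]
    constructor
    · refine le_of_mul_le_mul_right (h1.trans ?_) hI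
      gcongr
      linarith
    · have h3 : m * I ≤ (L + 1) * (I - D) :=
        h1.trans (mul_le_mul_of_nonneg_right hK1 hID)
      have h4 : D ≤ (1 - m / (L + 1)) * I := by
        have : m / (L + 1) * I ≤ I - D := by
          rw [div_mul_eq_mul_div, div_le_iff₀ (by linarith)]
          linarith
        linarith
      refine le_of_mul_le_mul_right (h2.trans ?_) hI
      rw [hDK]
      calc (p / s) ^ s * (K ^ s * D) ≤ (p / s) ^ s * (K ^ s * ((1 - m / (L + 1)) * I)) := by
            gcongr
        _ = _ := by ring
  have hev : ∀ᶠ K in 𝓝[>] L, m ≤ K ∧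
      firstEigenvalue Ω s ≤ (p / s) ^ s * K ^ s * (1 - m / (L + 1)) := by
    filter_upwards [Ioc_mem_nhdsGT (by linarith : L < L + 1)] with K hK using key K hK.1 hK.2
  -- Letting `K → L` gives `L ≥ m > 0`. Without this positivity the factor `1 - m/(L+1)` could not
  -- produce a strict inequality.
  have hmL : m ≤ L := ge_of_tendsto (tendsto_id.mono_left nhdsWithin_le_nhds)
    (hev.mono fun _ h ↦ h.1)
  have hlim : Tendsto (fun K : ℝ ↦ (p / s) ^ s * K ^ s * (1 - m / (L + 1))) (𝓝[>] L)
      (𝓝 ((p / s) ^ s * L ^ s * (1 - m / (L + 1)))) :=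
    (((Real.continuousAt_rpow_const L s (Or.inr hs0.le)).tendsto.const_mul _).mul_const
      _).mono_left nhdsWithin_le_nhds
  have hle := ge_of_tendsto hlim (hev.mono fun _ h ↦ h.2)
  have hLpos : 0 < L := hm.trans_le hmL
  have hlt : firstEigenvalue Ω s < (p / s * L) ^ s := by
    rw [Real.mul_rpow (by positivity) hL0]
    refine hle.trans_lt (mul_lt_of_lt_one_right (by positivity) ?_)
    have : 0 < m / (L + 1) := by positivity
    linarith
  have hroot : firstEigenvalue Ω s ^ (1 / s) < p / s * L := by
    rw [one_div]
    exact (Real.rpow_inv_lt_iff_of_pos firstEigenvalue_nonneg (by positivity) hs0).2 hlt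
  calc s * firstEigenvalue Ω s ^ (1 / s) < s * (p / s * L) := by gcongr
    _ = p * L := by field_simp

end PLaplace

theorem proposition3p1 (N : ℕ) (hN : 1 ≤ N)
    (Ω : TopologicalSpace.Opens (EuclideanSpace ℝ (Fin N)))
    (hΩ_ne : (Ω : Set (EuclideanSpace ℝ (Fin N))).Nonempty)
    (hΩ_bdd : Bornology.IsBounded (Ω : Set (EuclideanSpace ℝ (Fin N))))
    (s p : ℝ) (hs : 1 < s) (hsp : s < p) :
    s * (PLaplace.firstEigenvalueMinus Ω s) ^ (1 / s) ≤
        s * (PLaplace.firstEigenvalue Ω s) ^ (1 / s) ∧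
      s * (PLaplace.firstEigenvalue Ω s) ^ (1 / s) <
        p * (PLaplace.firstEigenvalueMinus Ω p) ^ (1 / p) ∧
      p * (PLaplace.firstEigenvalueMinus Ω p) ^ (1 / p) ≤
        p * (PLaplace.firstEigenvalue Ω p) ^ (1 / p) := by
  have : IsFiniteMeasure (volume.restrict (Ω : Set (EuclideanSpace ℝ (Fin N)))) :=
    ⟨by simpa using hΩ_bdd.measure_lt_top⟩
  have mono : ∀ t : ℝ, 1 < t → t * (PLaplace.firstEigenvalueMinus Ω t) ^ (1 / t) ≤
      t * (PLaplace.firstEigenvalue Ω t) ^ (1 / t) := fun t ht ↦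
    mul_le_mul_of_nonneg_left (Real.rpow_le_rpow PLaplace.firstEigenvalueMinus_nonneg
      (PLaplace.firstEigenvalueMinus_le hΩ_ne) (by positivity)) (by positivity)
  exact ⟨mono s hs, PLaplace.firstEigenvalue_lt hN hΩ_ne hΩ_bdd hs hsp, mono p (hs.trans hsp)⟩
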